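/- \textbf{Setting.} Fix $0<q<1$. A signature of length $N$ is a tuple of integers $\lambda_1\ge\dots\ge\lambda_N$, $|\lambda|=\sum_i\lambda_i$. For signatures $\mu,\lambda$ of lengths $N-1,N$ write $\mu\prec\lambda$ if $\lambda_{k+1}\le\mu_k\le\lambda_k$ for $1\le k\le N-1$, and put $s_{\lambda/\mu}(x)=x^{|\lambda|-|\mu|}\mathbf 1_{\mu\prec\lambda}$ (so $s_{\lambda}(x)=x^{\lambda_1}$ for $N=1$). Let $\mathcal S$ be the set of arrays $\lambda^{(1)}\prec\lambda^{(2)}\prec\cdots$ of infinite depth, $\lambda^{(N)}$ being a signature of length $N$. A probability measure on $\mathcal S$ is $q$-Gibbs if for every $N$, conditionally on $\lambda^{(N)}=\lambda$, the probability of $(\lambda^{(1)},\dots,\lambda^{(N-1)})$ is proportional to $s_{\lambda^{(1)}}(1)s_{\lambda^{(2)}/\lambda^{(1)}}(q)\cdots s_{\lambda/\lambda^{(N-1)}}(q^{N-1})$. \textbf{Specializations.} Let $\rho=(\alpha^\pm;\beta^\pm;\gamma^\pm)$ with $\alpha_1^\pm\ge\alpha_2^\pm\ge\dots\ge0$, $\beta_1^\pm\ge\beta_2^\pm\ge\dots\ge0$,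 $\gamma^\pm\ge0$, $\sum_i(\alpha_i^\pm+\beta_i^\pm)<\infty$, $\beta_1^++\beta_1^-\le1$. Let $\psi_n(\rho)$, $n\in\mathbb Z$, be the coefficients of the expansion, for $|u|=1$, $$\sum_{n\in\mathbb Z}\psi_n(\rho)u^n=e^{\gamma^+(u-1)+\gamma^-(u^{-1}-1)}\prod_{i\ge1}\frac{1+\beta_i^+(u-1)}{1-\alpha_i^+(u-1)}\cdot\frac{1+\beta_i^-(u^{-1}-1)}{1-\alpha_i^-(u^{-1}-1)},$$ and for a signature $\lambda$ of length $N$ put $s_\lambda(\rho)=\det[\psi_{\lambda_i+j-i}(\rho)]_{i,j=1}^N$. The two-sided Schur process $\mathbb P[(1,q,q^2,\dots)\mid\rho]$ is the unique $q$-Gibbs probability measure on $\mathcal S$ such that for every $N$ the joint probability weights of the first $N$ rows are $$\frac1Z\,s_{\lambda^{(1)}}(1)\,s_{\lambda^{(2)}/\lambda^{(1)}}(q)\cdots s_{\lambda^{(N)}/\lambda^{(N-1)}}(q^{N-1})\,s_{\lambda^{(N)}}(\rho),$$ with a normalizing constant $Z=Z_N$. \textbf{The map.} For $A\in\mathbb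 Z_{\ge0}$ and $a\in[0,1]$ let $Y_a(A)$ be the random variable on $\{0,\dots,A\}$ with $\mathrm{Prob}(Y=k)=(1-a)a^k$ for $k<A$ and $\mathrm{Prob}(Y=A)=a^A$. The Markov map $L^{(j)}_a$ on $\mathcal S$ changes only the row $\lambda^{(j)}$, replacing $\lambda^{(j)}_k$, $1\le k\le j$, by $m_k+Y_a(\lambda^{(j)}_k-m_k)$ with independent $Y$'s, where $m_k=\max\{\lambda^{(j-1)}_k,\lambda^{(j+1)}_{k+1}\}$ for $k<j$ and $m_j=\lambda^{(j+1)}_{j+1}$. For a probability measure $\mathsf M$ on $\mathcal S$ put $\mathsf M^{(0)}=\mathsf M$, $\mathsf M^{(j)}=\mathsf M^{(j-1)}L^{(j)}_{q^j}$, and let $\mathsf M\,\mathbb L^{(q)}$ be the measure under which, for each $N$, the joint distribution of $(\lambda^{(1)},\dots,\lambda^{(N)})$ is the one under $\mathsf M^{(N+1)}$. \textbf{Theorem.} Let $0<q<1$ and let $\rho$ be as above with $\alpha_i^-=0$ for all $i$. Then the processes below exist, are unique, and $$\mathbb P[(1,q,q^2,\dots)\mid\rho]\;\mathbb L^{(q)}=\mathbb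 P[(1,q,q^2,\dots)\mid\rho^{(q)}],$$ where $\rho^{(q)}$ is the specialization with parameters $$\hat\alpha_i^+=\frac{\alpha_i^+q}{1+\alpha_i^+-\alpha_i^+q},\quad \hat\alpha_i^-=0,\quad \hat\beta_i^+=\frac{\beta_i^+q}{1-\beta_i^++\beta_i^+q},\quad \hat\beta_i^-=\frac{\beta_i^-q^{-1}}{1-\beta_i^-+\beta_i^-q^{-1}},\quad \hat\gamma^+=q\gamma^+,\quad \hat\gamma^-=q^{-1}\gamma^-.$$ -/

import Mathlib

open MeasureTheory ProbabilityTheory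

namespace TwoSidedSchur

noncomputable section

/-! ### Arrays of integers of infinite depth -/

/-- Triangular arrays of integers of infinite depth: row `n` has `n` entries, and `A n k` is the
entry usually written `λ^{(n)}_{k+1}` (row `0` is empty). -/
abbrev Arr : Type := (n : ℕ) → Fin n → ℤ

/-- Interlacing `μ ≺ l` of two consecutive rows: `l₁ ≥ μ₁ ≥ l₂ ≥ μ₂ ≥ … ≥ μ_n ≥ l_{n+1}`. -/
def Interlace {n : ℕ} (μ : Fin n → ℤ) (l : Fin (n + 1) → ℤ) : Prop :=
  ∀ k : Fin n, l k.succ ≤ μ k ∧ μ k ≤ l k.castSucc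

/-- Interlacing arrays of signatures (the rows are then automatically nonincreasing). -/
def IsInterlacing (A : Arr) : Prop := ∀ n : ℕ, Interlace (A n) (A (n + 1))

/-- The event that the first `N` rows coincide with the first `N` rows of `a`.  The numbers
`M (cylinder N a)` are the joint probability weights of the first `N` rows under `M`. -/
def cylinder (N : ℕ) (a : Arr) : Set Arr := {A | ∀ n ≤ N, A n = a n}

/-! ### Skew Schur functions of one variable, and the Gibbs property -/

/-- `s_{l/μ}(x) = x^{|l| - |μ|}` if `μ ≺ l`, and `0` otherwise. -/
def skewSchur {n : ℕ} (x : ℝ) (l : Fin (n + 1) → ℤ) (μ : Fin n → ℤ) : ℝ :=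
  open Classical in if Interlace μ l then x ^ (∑ k, l k - ∑ k, μ k) else 0

/-- The product `s_{λ^{(1)}}(c₁) s_{λ^{(2)}/λ^{(1)}}(c₂) ⋯ s_{λ^{(N)}/λ^{(N-1)}}(c_N)`, where `c n`
stands for `c_{n+1}`. -/
def arrayWeight (c : ℕ → ℝ) (N : ℕ) (a : Arr) : ℝ :=
  ∏ n ∈ Finset.range N, skewSchur (c n) (a (n + 1)) (a n)

/-- The Schur function `s_l(c₁, …, c_N)` of a signature `l` of length `N`, by the branching rule
(the sum has finitely many nonzero terms). -/
def schurFin (c : ℕ → ℝ) : (N : ℕ) → (Fin N → ℤ) → ℝ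
  | 0, _ => 1
  | N + 1, l => ∑' μ : Fin N → ℤ, schurFin c N μ * skewSchur (c N) l μ

/-- The `c`-Gibbs property: conditionally on the `N`-th row, the first `N` rows have
probability `arrayWeight / s_{λ^{(N)}}(c₁, …, c_N)`. -/
def IsGibbs (c : ℕ → ℝ) (M : Measure Arr) : Prop :=
  ∀ (N : ℕ) (a : Arr),
    M.real (cylinder N a) * schurFin c N (a N) = M.real {A | A N = a N} * arrayWeight c N a

/-! ### Specializations -/

/-- Parameters `(α^±; β^±; γ^±)`; index `i` stands for the usual index `i + 1`. -/
structure Specialization where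
  αp : ℕ → ℝ
  αm : ℕ → ℝ
  βp : ℕ → ℝ
  βm : ℕ → ℝ
  γp : ℝ
  γm : ℝ
  αp_anti : Antitone αp
  αm_anti : Antitone αm
  βp_anti : Antitone βp
  βm_anti : Antitone βm
  αp_nonneg : ∀ i, 0 ≤ αp i
  αm_nonneg : ∀ i, 0 ≤ αm i
  βp_nonneg : ∀ i, 0 ≤ βp i
  βm_nonneg : ∀ i, 0 ≤ βm i
  γp_nonneg : 0 ≤ γp
  γm_nonneg : 0 ≤ γm
  αp_summable : Summable αp
  αm_summable : Summable αm
  βp_summable : Summable βp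
  βm_summable : Summable βm
  β_le_one : βp 0 + βm 0 ≤ 1

/-- The generating function `Ψ(u; ρ)`. -/
def genFun (ρ : Specialization) (u : ℂ) : ℂ :=
  Complex.exp (ρ.γp * (u - 1) + ρ.γm * (u⁻¹ - 1)) *
    ∏' i : ℕ, ((1 + ρ.βp i * (u - 1)) / (1 - ρ.αp i * (u - 1)) *
      ((1 + ρ.βm i * (u⁻¹ - 1)) / (1 - ρ.αm i * (u⁻¹ - 1))))

/-- The Laurent coefficient `ψ_n(ρ)` of `Ψ(u; ρ)` on the circle `|u| = 1`,
`ψ_n = (2πi)⁻¹ ∮ Ψ(u) u^{-n-1} du` (which is a real number). -/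
def psi (ρ : Specialization) (n : ℤ) : ℝ :=
  ((2 * Real.pi * Complex.I)⁻¹ * ∮ u in C(0, 1), genFun ρ u * u ^ (-n - 1)).re

/-- `s_l(ρ) = det [ψ_{l_i + j - i}(ρ)]_{i,j=1}^N`. -/
def schurSpec (ρ : Specialization) {N : ℕ} (l : Fin N → ℤ) : ℝ :=
  (Matrix.of fun i j : Fin N => psi ρ (l i + (j : ℕ) - (i : ℕ))).det

/-- `M` is the two-sided ascending Schur process with spectral parameters `1, q, q², …` and
specialization `ρ`: a `q`-Gibbs probability measure on interlacing arrays of signatures such that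
for every `N` the joint probability weights of the first `N` rows are
`Z⁻¹ s_{λ^{(1)}}(1) s_{λ^{(2)}/λ^{(1)}}(q) ⋯ s_{λ^{(N)}/λ^{(N-1)}}(q^{N-1}) s_{λ^{(N)}}(ρ)`.
The normalizing constant `Z` depends only on `N`; it equals the sum of the products, as `M` has
total mass one. -/
structure IsSchurProcess (q : ℝ) (ρ : Specialization) (M : Measure Arr) : Prop where
  isProbabilityMeasure : IsProbabilityMeasure M
  interlacing : ∀ᵐ A ∂M, IsInterlacing A
  gibbs : IsGibbs (fun n => q ^ n) M
  weight : ∀ N : ℕ, ∃ Z : ℝ, 0 < Z ∧ ∀ a : Arr,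
    M.real (cylinder N a) = 1 / Z * (arrayWeight (fun n => q ^ n) N a * schurSpec ρ (a N))

/-! ### The Markov maps -/

/-- The truncated geometric distribution on `{0, …, A}` with parameter `α ∈ [0, 1]`. -/
def truncGeom (α : ℝ) (A : ℕ) : Measure ℕ :=
  ∑ k ∈ Finset.range A, ENNReal.ofReal ((1 - α) * α ^ k) • Measure.dirac k +
    ENNReal.ofReal (α ^ A) • Measure.dirac A

/-- The left end of the segment to which the entry `k` of the middle one of three consecutive rows
`μ, _, ν` is constrained by interlacing.  The last entry of the middle row is bounded from below
only by the row `ν`. -/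
def lowerEnd {m : ℕ} (μ : Fin m → ℤ) (ν : Fin (m + 2) → ℤ) (k : Fin (m + 1)) : ℤ :=
  if h : (k : ℕ) < m then max (μ ⟨k, h⟩) (ν k.succ) else ν k.succ

/-- The law of the independent truncated geometric variables `Y^{(1)}, …, Y^{(m+1)}` used to update
the row `l` between the rows `μ` and `ν`. -/
def jumpLaw (α : ℝ) {m : ℕ} (μ : Fin m → ℤ) (l : Fin (m + 1) → ℤ) (ν : Fin (m + 2) → ℤ) :
    Measure (Fin (m + 1) → ℕ) :=
  Measure.pi fun k => truncGeom α (l k - lowerEnd μ ν k).toNat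

/-- Replace the row `j = m + 1` of `A` by `lowerEnd + Y`. -/
def updateRow (m : ℕ) (A : Arr) (Y : Fin (m + 1) → ℕ) : Arr :=
  Function.update A (m + 1) fun k => lowerEnd (A m) (A (m + 2)) k + Y k

theorem truncGeom_univ {α : ℝ} (h0 : 0 ≤ α) (h1 : α ≤ 1) (A : ℕ) :
    truncGeom α A Set.univ = 1 := by
  simp only [truncGeom, Measure.add_apply, Measure.finsetSum_apply, Measure.smul_apply,
    measure_univ, smul_eq_mul, mul_one]
  rw [← ENNReal.ofReal_sum_of_nonneg
      (fun k _ => mul_nonneg (sub_nonneg.2 h1) (pow_nonneg h0 k)),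
    ← ENNReal.ofReal_add
      (Finset.sum_nonneg fun k _ => mul_nonneg (sub_nonneg.2 h1) (pow_nonneg h0 k))
      (pow_nonneg h0 A), ← Finset.mul_sum, mul_neg_geom_sum]
  simp

theorem finite_truncGeom (α : ℝ) (A : ℕ) : IsFiniteMeasure (truncGeom α A) := by
  refine ⟨?_⟩
  simp only [truncGeom, Measure.add_apply, Measure.finsetSum_apply, Measure.smul_apply,
    measure_univ, smul_eq_mul, mul_one]
  exact ENNReal.add_lt_top.2
    ⟨ENNReal.sum_lt_top.2 fun _ _ => ENNReal.ofReal_lt_top, ENNReal.ofReal_lt_top⟩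

theorem finite_jumpLaw (α : ℝ) {m : ℕ} (μ : Fin m → ℤ) (l : Fin (m + 1) → ℤ)
    (ν : Fin (m + 2) → ℤ) : IsFiniteMeasure (jumpLaw α μ l ν) := by
  have := finite_truncGeom α
  unfold jumpLaw
  infer_instance

theorem measurable_updateRow (m : ℕ) :
    Measurable fun p : Arr × (Fin (m + 1) → ℕ) => updateRow m p.1 p.2 := by
  refine measurable_pi_lambda _ fun n => ?_
  by_cases h : n = m + 1
  · subst h
    simp only [updateRow, Function.update_self]
    have hg : Measurable fun t : (Fin m → ℤ) × (Fin (m + 2) → ℤ) × (Fin (m + 1) → ℕ) =>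
        (fun k => lowerEnd t.1 t.2.1 k + (t.2.2 k : ℤ)) := measurable_of_countable _
    have hrow : ∀ i : ℕ, Measurable fun A : Arr => A i := fun i => measurable_pi_apply i
    have ht : Measurable fun p : Arr × (Fin (m + 1) → ℕ) => (p.1 m, p.1 (m + 2), p.2) :=
      ((hrow m).comp measurable_fst).prodMk
        (((hrow (m + 2)).comp measurable_fst).prodMk measurable_snd)
    exact hg.comp ht
  · simp only [updateRow, Function.update_of_ne h]
    exact (measurable_pi_apply n).comp measurable_fst

theorem measurable_lmap (α : ℝ) (m : ℕ) :
    Measurable fun A : Arr =>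
      (jumpLaw α (A m) (A (m + 1)) (A (m + 2))).map (updateRow m A) := by
  refine Measure.measurable_of_measurable_coe _ fun s hs => ?_
  have hu : ∀ A : Arr, Measurable (updateRow m A) := fun A =>
    (measurable_updateRow m).comp measurable_prodMk_left
  have hS : ∀ Y : Fin (m + 1) → ℕ, MeasurableSet {A : Arr | updateRow m A Y ∈ s} := fun Y =>
    ((measurable_updateRow m).comp (measurable_id.prodMk measurable_const)) hs
  have hrow : ∀ i : ℕ, Measurable fun A : Arr => A i := fun i => measurable_pi_apply i
  have hrows : Measurable fun A : Arr => (A m, A (m + 1), A (m + 2)) :=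
    (hrow m).prodMk ((hrow (m + 1)).prodMk (hrow (m + 2)))
  have key : ∀ A : Arr, (jumpLaw α (A m) (A (m + 1)) (A (m + 2))).map (updateRow m A) s =
      ∑' Y : Fin (m + 1) → ℕ, {A : Arr | updateRow m A Y ∈ s}.indicator
        (fun A => jumpLaw α (A m) (A (m + 1)) (A (m + 2)) {Y}) A := by
    intro A
    rw [Measure.map_apply (hu A) hs,
      ← Measure.tsum_indicator_apply_singleton _ _ (hu A hs)]
    refine tsum_congr fun Y => ?_
    rfl
  have hg : ∀ Y : Fin (m + 1) → ℕ, Measurable fun A : Arr =>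
      jumpLaw α (A m) (A (m + 1)) (A (m + 2)) {Y} := by
    intro Y
    have hY : Measurable fun t : (Fin m → ℤ) × (Fin (m + 1) → ℤ) × (Fin (m + 2) → ℤ) =>
        jumpLaw α t.1 t.2.1 t.2.2 {Y} := measurable_of_countable _
    have h := hY.comp hrows
    exact h
  have hsum : ∀ Y : Fin (m + 1) → ℕ, Measurable ({A : Arr | updateRow m A Y ∈ s}.indicator
      (fun A => jumpLaw α (A m) (A (m + 1)) (A (m + 2)) {Y})) := fun Y => (hg Y).indicator (hS Y)
  have h : Measurable fun A => ∑' Y : Fin (m + 1) → ℕ, {A : Arr | updateRow m A Y ∈ s}.indicator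
      (fun A => jumpLaw α (A m) (A (m + 1)) (A (m + 2)) {Y}) A := Measurable.tsum hsum
  rw [funext key]
  exact h

/-- The Markov map `L_α^{(j)}` with `j = m + 1`: it changes only the row `j`, whose entries become
`λ^{(j)}_k ↦ max(λ^{(j-1)}_k, λ^{(j+1)}_{k+1}) + Y^{(k)}`. -/
def lmap (α : ℝ) (m : ℕ) : Kernel Arr Arr where
  toFun A := (jumpLaw α (A m) (A (m + 1)) (A (m + 2))).map (updateRow m A)
  measurable' := measurable_lmap α m

theorem isMarkovKernel_lmap {α : ℝ} (h0 : 0 ≤ α) (h1 : α ≤ 1) (m : ℕ) :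
    IsMarkovKernel (lmap α m) := by
  refine ⟨fun A => ⟨?_⟩⟩
  have := fun A => IsProbabilityMeasure.mk (truncGeom_univ h0 h1 A)
  have hu : Measurable (updateRow m A) := (measurable_updateRow m).comp measurable_prodMk_left
  change (jumpLaw α (A m) (A (m + 1)) (A (m + 2))).map (updateRow m A) Set.univ = 1
  rw [Measure.map_apply hu MeasurableSet.univ, jumpLaw, Set.preimage_univ, measure_univ]

/-- `M^{(0)} = M` and `M^{(j)} = M^{(j-1)} L^{(j)}_{q^j}`. -/
def lseq (q : ℝ) (M : Measure Arr) : ℕ → Measure Arr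
  | 0 => M
  | j + 1 => (lseq q M j).bind (lmap (q ^ (j + 1)) j)

/-- `M'` is the image of `M` under the iterated map: for each `N`, the joint distribution of the
first `N` rows under `M'` is their joint distribution under `M^{(N+1)}`. -/
def IsIteratedLImage (q : ℝ) (M M' : Measure Arr) : Prop :=
  ∀ (N : ℕ) (a : Arr), M' (cylinder N a) = lseq q M (N + 1) (cylinder N a)

/-! ### The modified specialization -/

theorem mod_denom_pos {c x : ℝ} (hc : 0 < c) (hx0 : 0 ≤ x) (hx1 : x ≤ 1) :
    0 < 1 - x + x * c := by
  rcases hx0.eq_or_lt with h | h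
  · subst h; norm_num
  · nlinarith [mul_pos h hc]

theorem mod_mono {c x y : ℝ} (hc : 0 < c) (hx0 : 0 ≤ x) (hxy : x ≤ y) (hy1 : y ≤ 1) :
    x * c / (1 - x + x * c) ≤ y * c / (1 - y + y * c) := by
  rw [div_le_div_iff₀ (mod_denom_pos hc hx0 (hxy.trans hy1))
    (mod_denom_pos hc (hx0.trans hxy) hy1)]
  nlinarith [mul_le_mul_of_nonneg_right hxy hc.le]

theorem mod_nonneg {c x : ℝ} (hc : 0 < c) (hx0 : 0 ≤ x) (hx1 : x ≤ 1) :
    0 ≤ x * c / (1 - x + x * c) :=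
  div_nonneg (mul_nonneg hx0 hc.le) (mod_denom_pos hc hx0 hx1).le

theorem mod_le {c x : ℝ} (hc : 0 < c) (hx0 : 0 ≤ x) (hx1 : x ≤ 1) :
    x * c / (1 - x + x * c) ≤ (1 + c) * x := by
  rw [div_le_iff₀ (mod_denom_pos hc hx0 hx1)]
  have h1 : 0 ≤ 1 - x := sub_nonneg.2 hx1
  have h : (1 + c) * x * (1 - x + x * c) - x * c = x * ((1 - x) + x * c ^ 2) := by ring
  nlinarith [mul_nonneg hx0 (add_nonneg h1 (mul_nonneg hx0 (sq_nonneg c)))]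

theorem mod_summable {c : ℝ} (hc : 0 < c) {f : ℕ → ℝ} (h0 : ∀ i, 0 ≤ f i) (h1 : ∀ i, f i ≤ 1)
    (hf : Summable f) : Summable fun i => f i * c / (1 - f i + f i * c) :=
  Summable.of_nonneg_of_le (fun i => mod_nonneg hc (h0 i) (h1 i))
    (fun i => mod_le hc (h0 i) (h1 i)) (hf.mul_left (1 + c))

theorem mod_add_le {c x y : ℝ} (hc : 0 < c) (hx0 : 0 ≤ x) (hy0 : 0 ≤ y) (hxy : x + y ≤ 1) :
    x * c / (1 - x + x * c) + y * c⁻¹ / (1 - y + y * c⁻¹) ≤ 1 := by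
  have hx1 : x ≤ 1 := by linarith
  have hd := mod_denom_pos hc hx0 hx1
  have hm := mod_mono (inv_pos.2 hc) hy0 (show y ≤ 1 - x by linarith) (by linarith)
  have he : (1 - x) * c⁻¹ / (1 - (1 - x) + (1 - x) * c⁻¹) = (1 - x) / (1 - x + x * c) := by
    have h2 : 0 < 1 - (1 - x) + (1 - x) * c⁻¹ :=
      mod_denom_pos (inv_pos.2 hc) (by linarith) (by linarith)
    rw [div_eq_div_iff h2.ne' hd.ne']
    field_simp
    ring
  have hs : x * c / (1 - x + x * c) + (1 - x) / (1 - x + x * c) = 1 := by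
    rw [← add_div, div_eq_one_iff_eq hd.ne']
    ring
  rw [he] at hm
  linarith

theorem Specialization.βp_le_one (ρ : Specialization) (i : ℕ) : ρ.βp i ≤ 1 := by
  linarith [ρ.βp_anti (Nat.zero_le i), ρ.βm_nonneg 0, ρ.β_le_one]

theorem Specialization.βm_le_one (ρ : Specialization) (i : ℕ) : ρ.βm i ≤ 1 := by
  linarith [ρ.βm_anti (Nat.zero_le i), ρ.βp_nonneg 0, ρ.β_le_one]

theorem αmod_denom {q x : ℝ} (hq1 : q < 1) (hx : 0 ≤ x) : 1 ≤ 1 + x - x * q := by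
  nlinarith

/-- The specialization `ρ^{(q)}`. -/
def Specialization.modify (ρ : Specialization) (q : ℝ) (hq : 0 < q) (hq1 : q < 1) :
    Specialization where
  αp i := ρ.αp i * q / (1 + ρ.αp i - ρ.αp i * q)
  αm _ := 0
  βp i := ρ.βp i * q / (1 - ρ.βp i + ρ.βp i * q)
  βm i := ρ.βm i * q⁻¹ / (1 - ρ.βm i + ρ.βm i * q⁻¹)
  γp := q * ρ.γp
  γm := q⁻¹ * ρ.γm
  αp_anti := fun i j hij => by
    have hx := ρ.αp_nonneg j
    have hxy := ρ.αp_anti hij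
    have h1 := αmod_denom hq1 hx
    have h2 := αmod_denom hq1 (ρ.αp_nonneg i)
    change _ / _ ≤ _ / _
    rw [div_le_div_iff₀ (by linarith) (by linarith)]
    nlinarith [mul_le_mul_of_nonneg_right hxy hq.le]
  αm_anti := fun _ _ _ => le_rfl
  βp_anti := fun i j hij => mod_mono hq (ρ.βp_nonneg j) (ρ.βp_anti hij) (ρ.βp_le_one i)
  βm_anti := fun i j hij =>
    mod_mono (inv_pos.2 hq) (ρ.βm_nonneg j) (ρ.βm_anti hij) (ρ.βm_le_one i)
  αp_nonneg := fun i => div_nonneg (mul_nonneg (ρ.αp_nonneg i) hq.le)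
    (zero_le_one.trans (αmod_denom hq1 (ρ.αp_nonneg i)))
  αm_nonneg := fun _ => le_rfl
  βp_nonneg := fun i => mod_nonneg hq (ρ.βp_nonneg i) (ρ.βp_le_one i)
  βm_nonneg := fun i => mod_nonneg (inv_pos.2 hq) (ρ.βm_nonneg i) (ρ.βm_le_one i)
  γp_nonneg := mul_nonneg hq.le ρ.γp_nonneg
  γm_nonneg := mul_nonneg (inv_nonneg.2 hq.le) ρ.γm_nonneg
  αp_summable := Summable.of_nonneg_of_le
    (fun i => div_nonneg (mul_nonneg (ρ.αp_nonneg i) hq.le)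
      (zero_le_one.trans (αmod_denom hq1 (ρ.αp_nonneg i))))
    (fun i => div_le_self (mul_nonneg (ρ.αp_nonneg i) hq.le) (αmod_denom hq1 (ρ.αp_nonneg i)))
    (ρ.αp_summable.mul_right q)
  αm_summable := summable_zero
  βp_summable := mod_summable hq ρ.βp_nonneg ρ.βp_le_one ρ.βp_summable
  βm_summable := mod_summable (inv_pos.2 hq) ρ.βm_nonneg ρ.βm_le_one ρ.βm_summable
  β_le_one := mod_add_le hq (ρ.βp_nonneg 0) (ρ.βm_nonneg 0) ρ.β_le_one

end

end TwoSidedSchur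

namespace TwoSidedSchur

/-! ### Totally positive sequences -/

/-! Fix the rows μ and ν on either side of row j. If rows j and j+1 carry parameters x and αx, the
conditional weight of row j is a product over its entries of geometric weights α^{-l} on the
segments allowed by interlacing. Exchanging the two parameters replaces α^{-l} by α^{l} on the same
segments; the constants match because the ends of all segments sum to |μ| + |ν|. A truncated
geometric jump from the left end reverses a geometric distribution, so L_α exchanges the two
parameters and leaves the rest of the weight alone (`hasSum_skewSchur_swap`, `bind_lmap_weight`).
Taking α = q, q², … carries the parameter 1 along the list: after m maps the parameters are q, …,
q^m, 1, q^{m+1}, … (`lseq_weight`).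

Hence the first N rows under M^{(N+1)} have parameters q, …, q^N. By homogeneity this is the weight
for 1, …, q^{N-1} times q^{|λ^{(N)}|}, and the specialization absorbs the extra power. Indeed Ψ(qu;
ρ) = Ψ(q; ρ) Ψ(u; ρ^{(q)}), and since α^- = 0 the contour |u| = 1 may be moved to |u| = q; so q^n
ψ_n(ρ) = g ψ_n(ρ^{(q)}) and q^{|λ|} s_λ(ρ) = g^N s_λ(ρ^{(q)}) (`exists_schurSpec_modify`). The
constants are fixed by total mass.

Existence rests on two facts: s_λ(ρ) ≥ 0, because every factor of Ψ preserves nonnegativity of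
Toeplitz minors (`isPositiveSymbol_genFun`), and the branching identity ∑_λ s_{λ/μ}(x) s_λ(ρ) = G(x)
s_μ(ρ) with G(x) > 0 (`hasSum_skewSchur_mul_det`). They turn the weights into a Markov chain of
rows. Uniqueness holds because cylinders determine the measure. -/

/-- The minors of the Toeplitz matrix of `a` formed by arbitrary rows and consecutive columns are
nonnegative. -/
def ToeplitzNonneg (a : ℤ → ℝ) : Prop :=
  ∀ (N : ℕ) (x : Fin N → ℤ), StrictMono x →
    0 ≤ (Matrix.of fun i j : Fin N => a (x i - (j : ℕ))).det

/-- Ties produce equal rows, hence vanishing minors. This allows the rows to be expanded into terms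
that may collide. -/
theorem ToeplitzNonneg.det_nonneg_of_monotone {a : ℤ → ℝ} (ha : ToeplitzNonneg a) {N : ℕ}
    {x : Fin N → ℤ} (hx : Monotone x) :
    0 ≤ (Matrix.of fun i j : Fin N => a (x i - (j : ℕ))).det := by
  by_cases h : Function.Injective x
  · exact ha N x (hx.strictMono_of_injective h)
  · simp only [Function.Injective, not_forall] at h
    obtain ⟨i, k, hik, hne⟩ := h
    rw [Matrix.det_zero_of_row_eq hne]
    funext j
    simp [hik]

/-- Nonnegative combinations of earlier rows preserve nonnegativity as long as every choice of
terms keeps the rows in order. -/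
theorem ToeplitzNonneg.det_sum_nonneg {a : ℤ → ℝ} (ha : ToeplitzNonneg a) {N : ℕ}
    (x : Fin N → ℤ) (K : Fin N → ℕ) (w : Fin N → ℕ → ℝ) (hw : ∀ i k, 0 ≤ w i k)
    (hx : ∀ r : Fin N → ℕ, (∀ i, r i < K i) → Monotone fun i => x i - r i) :
    0 ≤ (Matrix.of fun i j : Fin N =>
      ∑ k ∈ Finset.range (K i), w i k * a (x i - k - (j : ℕ))).det := by
  -- Multilinearity: each choice r of one term per row contributes a nonnegative scalar times the
  -- minor with rows x i - r i.
  have h := (Matrix.detRowAlternating (n := Fin N) (R := ℝ)).toMultilinearMap.map_sum_finset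
    (fun (i : Fin N) (k : ℕ) (j : Fin N) => w i k * a (x i - k - (j : ℕ)))
    (fun i => Finset.range (K i))
  have e : (Matrix.of fun i j : Fin N =>
      ∑ k ∈ Finset.range (K i), w i k * a (x i - k - (j : ℕ))) =
      Matrix.of fun i => ∑ k ∈ Finset.range (K i), fun j : Fin N =>
        w i k * a (x i - k - (j : ℕ)) := by
    ext i j
    simp
  rw [e]
  refine le_of_le_of_eq ?_ h.symm
  refine Finset.sum_nonneg fun r hr => ?_
  have hr' : ∀ i, r i < K i := by simpa using hr
  have := Matrix.det_mul_column (fun i => w i (r i))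
    (Matrix.of fun i j : Fin N => a (x i - r i - (j : ℕ)))
  refine le_of_le_of_eq (mul_nonneg (Finset.prod_nonneg fun i _ => hw i (r i))
    (ha.det_nonneg_of_monotone (hx r hr'))) this.symm

/-- A nonzero Leibniz term forces x (σ i) = i for all i, so σ⁻¹ is strictly increasing and hence the
identity; only the diagonal product can survive. -/
theorem toeplitzNonneg_single : ToeplitzNonneg fun n => if n = 0 then 1 else 0 := by
  intro N x hx
  rw [Matrix.det_apply]
  refine Finset.sum_nonneg fun σ _ => ?_
  by_cases h : ∀ i, x (σ i) = (i : ℕ)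
  · have hσ : StrictMono σ.symm := fun i k hik => by
      have h1 := h (σ.symm i)
      have h2 := h (σ.symm k)
      rw [Equiv.apply_symm_apply] at h1 h2
      have := hx hik
      rw [h1, h2] at this
      exact_mod_cast this
    have h1 : σ.symm = 1 := by
      ext i
      exact congrArg Fin.val (DFunLike.congr_fun (Subsingleton.elim
        (hσ.orderIsoOfSurjective _ σ.symm.surjective) (OrderIso.refl _)) i)
    have h2 : σ = 1 := by rw [← Equiv.symm_symm σ, h1]; rfl
    subst h2
    simp only [Matrix.of_apply, Equiv.Perm.sign_one, one_smul]
    exact Finset.prod_nonneg fun i _ => by split_ifs <;> norm_num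
  · simp only [not_forall] at h
    obtain ⟨i, hi⟩ := h
    have : ∏ i : Fin N, (Matrix.of fun i j : Fin N =>
        if x i - ((j : ℕ) : ℤ) = 0 then (1 : ℝ) else 0) (σ i) i = 0 := by
      refine Finset.prod_eq_zero (Finset.mem_univ i) ?_
      simp [sub_eq_zero, hi]
    rw [this, smul_zero]

theorem ToeplitzNonneg.shift {a : ℤ → ℝ} (ha : ToeplitzNonneg a) (s : ℤ) :
    ToeplitzNonneg fun n => a (n + s) := by
  intro N x hx
  have := ha N (fun i => x i + s) (hx.add_const s)
  refine this.trans_eq (congrArg _ ?_)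
  ext i j
  simp only [Matrix.of_apply]
  congr 1
  ring

/-- This is multiplication of the generating series by p + r u. Lowering some entries of a strictly
increasing integer sequence by one leaves it weakly increasing. -/
theorem ToeplitzNonneg.add_shift {a : ℤ → ℝ} (ha : ToeplitzNonneg a) {p r : ℝ} (hp : 0 ≤ p)
    (hr : 0 ≤ r) : ToeplitzNonneg fun n => p * a n + r * a (n - 1) := by
  intro N x hx
  have := ha.det_sum_nonneg x (fun _ => 2) (fun _ k => if k = 0 then p else r)
    (fun _ k => by split_ifs <;> assumption) fun t ht i k hik => by
      rcases hik.eq_or_lt with h | h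
      · rw [h]
      · have h1 := hx h
        have h2 := ht k
        simp only
        omega
  refine this.trans_eq (congrArg _ ?_)
  ext i j
  simp only [Matrix.of_apply, Finset.sum_range_succ, Finset.sum_range_zero]
  simp only [if_true, one_ne_zero, if_false, Nat.cast_zero, Nat.cast_one, zero_add, sub_zero]
  congr 3
  ring

theorem ToeplitzNonneg.of_tendsto {a : ℕ → ℤ → ℝ} {b : ℤ → ℝ}
    (ha : ∀ᶠ M in Filter.atTop, ToeplitzNonneg (a M))
    (h : ∀ n, Filter.Tendsto (fun M => a M n) Filter.atTop (nhds (b n))) :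
    ToeplitzNonneg b := by
  intro N x hx
  have hc : Filter.Tendsto (fun M => (Matrix.of fun i j : Fin N => a M (x i - (j : ℕ))).det)
      Filter.atTop (nhds (Matrix.of fun i j : Fin N => b (x i - (j : ℕ))).det) := by
    simp only [Matrix.det_apply]
    refine tendsto_finsetSum _ fun σ _ => ?_
    refine Filter.Tendsto.const_smul (tendsto_finsetProd _ fun i _ => ?_) _
    exact h _
  exact ge_of_tendsto hc (ha.mono fun M hM => hM N x hx)

theorem eq_geom_sum_of_recurrence {a c : ℤ → ℝ} {s : ℝ} (h : ∀ n, c n = a n + s * c (n - 1))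
    (n : ℤ) (K : ℕ) :
    c n = ∑ k ∈ Finset.range K, s ^ k * a (n - k) + s ^ K * c (n - K) := by
  induction K with
  | zero => simp
  | succ K ih =>
    rw [Finset.sum_range_succ, ih, h (n - K)]
    push_cast
    rw [show n - (K : ℤ) - 1 = n - (K + 1) by ring]
    ring

/-- This is division of the generating series by 1 - s u. Each row of c is expanded only down to the
preceding row; the remainder is a multiple of that row and is removed by row operations. The
remaining terms of different rows have arguments in disjoint intervals, so every choice keeps the
rows in order. The first row has no predecessor: it is cut after K terms, and the bound on c kills
its remainder as K → ∞. -/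
theorem ToeplitzNonneg.of_recurrence {a c : ℤ → ℝ} (ha : ToeplitzNonneg a) {s : ℝ} (hs : 0 ≤ s)
    (hs1 : s < 1) (h : ∀ n, c n = a n + s * c (n - 1)) {B : ℝ} (hB : ∀ n, |c n| ≤ B) :
    ToeplitzNonneg c := by
  intro N x hx
  rcases N with _ | N
  · simp
  -- Number of terms kept: K in the first row, the gap to the preceding row in the others.
  let D : ℕ → Fin (N + 1) → ℕ := fun K => Fin.cons K fun i => (x i.succ - x i.castSucc).toNat
  have key : ∀ K : ℕ, 0 ≤ (Matrix.of fun i j : Fin (N + 1) =>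
      ∑ k ∈ Finset.range (D K i), s ^ k * a (x i - k - (j : ℕ))).det := by
    intro K
    refine ha.det_sum_nonneg x (D K) (fun _ k => s ^ k) (fun _ k => pow_nonneg hs k) ?_
    intro r hr
    refine Fin.monotone_iff_le_succ.2 fun i => ?_
    have h1 := hr i.succ
    have h2 := hx (Fin.castSucc_lt_succ (i := i))
    simp only [D, Fin.cons_succ] at h1
    omega
  have hlim : Filter.Tendsto (fun K => (Matrix.of fun i j : Fin (N + 1) =>
      ∑ k ∈ Finset.range (D K i), s ^ k * a (x i - k - (j : ℕ))).det) Filter.atTop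
      (nhds (Matrix.of fun i j : Fin (N + 1) => (Fin.cons (c (x 0 - (j : ℕ)))
        (fun i' : Fin N => ∑ k ∈ Finset.range (D 0 i'.succ),
          s ^ k * a (x i'.succ - k - (j : ℕ))) : Fin (N + 1) → ℝ) i).det) := by
    simp only [Matrix.det_apply]
    refine tendsto_finsetSum _ fun σ _ => ?_
    refine Filter.Tendsto.const_smul (tendsto_finsetProd _ fun i _ => ?_) _
    simp only [Matrix.of_apply]
    refine Fin.cases ?_ (fun i' => ?_) (σ i)
    · simp only [D, Fin.cons_zero]
      have e : ∀ K : ℕ, ∑ k ∈ Finset.range K, s ^ k * a (x 0 - k - (i : ℕ)) =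
          c (x 0 - (i : ℕ)) - s ^ K * c (x 0 - (i : ℕ) - K) := fun K => by
        rw [eq_geom_sum_of_recurrence h (x 0 - (i : ℕ)) K, add_sub_cancel_right]
        simp only [sub_right_comm]
      simp only [e]
      have h0 : Filter.Tendsto (fun K : ℕ => s ^ K * c (x 0 - (i : ℕ) - K)) Filter.atTop
          (nhds 0) := by
        refine squeeze_zero_norm (a := fun K => s ^ K * B) (fun K => ?_) ?_
        · rw [norm_mul, Real.norm_of_nonneg (pow_nonneg hs K)]
          exact mul_le_mul_of_nonneg_left (hB _) (pow_nonneg hs K)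
        · simpa using (tendsto_pow_atTop_nhds_zero_of_lt_one hs hs1).mul_const B
      simpa using h0.const_sub (c (x 0 - (i : ℕ)))
    · simp only [D, Fin.cons_succ]
      exact tendsto_const_nhds
  have h0 := ge_of_tendsto' hlim key
  refine h0.trans_eq (Eq.symm ?_)
  refine Matrix.det_eq_of_forall_row_eq_smul_add_pred
    (fun i => s ^ (x i.succ - x i.castSucc).toNat) (fun j => by simp) fun i j => ?_
  have h2 := hx (Fin.castSucc_lt_succ (i := i))
  have h3 : (((x i.succ - x i.castSucc).toNat : ℕ) : ℤ) = x i.succ - x i.castSucc :=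
    Int.toNat_of_nonneg (by omega)
  simp only [Matrix.of_apply, Fin.cons_succ, D]
  rw [eq_geom_sum_of_recurrence h (x i.succ - (j : ℕ)) (x i.succ - x i.castSucc).toNat, h3]
  simp only [sub_right_comm _ ((j : ℕ) : ℤ)]
  congr 4
  ring

/-- Nonnegativity of the determinants `det [a_{l_i + j - i}]` indexed by signatures. -/
theorem ToeplitzNonneg.schur_nonneg {a : ℤ → ℝ} (ha : ToeplitzNonneg a) {N : ℕ} {l : Fin N → ℤ}
    (hl : Antitone l) :
    0 ≤ (Matrix.of fun i j : Fin N => a (l i + (j : ℕ) - (i : ℕ))).det := by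
  rw [← Matrix.det_submatrix_equiv_self Fin.revPerm]
  -- Rows and columns are both reversed; the shift N - 1 comes from j.rev = N - 1 - j.
  have := ha N (fun i => l i.rev - (i.rev : ℕ) + (N - 1)) fun i k hik => by
    have h1 := hl (Fin.rev_le_rev.2 hik.le)
    have h2 : ((k.rev : ℕ) : ℤ) < (i.rev : ℕ) := by exact_mod_cast Fin.rev_lt_rev.2 hik
    simp only
    omega
  refine this.trans_eq (congrArg _ ?_)
  ext i j
  simp only [Matrix.of_apply, Matrix.submatrix_apply, Fin.revPerm_apply]
  congr 1
  have := Fin.val_rev j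
  omega

/-! ### Laurent coefficients on the unit circle -/

/-- The real part of the `n`-th Laurent coefficient of `f` on the unit circle. -/
noncomputable def laurentCoeff (f : ℂ → ℂ) (n : ℤ) : ℝ :=
  ((2 * Real.pi * Complex.I)⁻¹ * ∮ u in C(0, 1), f u * u ^ (-n - 1)).re

theorem ne_zero_of_mem_sphere {r : ℝ} (hr : 0 < r) {u : ℂ} (hu : u ∈ Metric.sphere (0 : ℂ) r) :
    u ≠ 0 := by
  rintro rfl
  simp [hr.ne] at hu

theorem continuousOn_mul_zpow {f : ℂ → ℂ} {r : ℝ} (hr : 0 < r)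
    (hf : ContinuousOn f (Metric.sphere 0 r)) (k : ℤ) :
    ContinuousOn (fun u => f u * u ^ k) (Metric.sphere 0 r) :=
  hf.mul (continuousOn_id.zpow₀ k fun _ hu => Or.inl (ne_zero_of_mem_sphere hr hu))

theorem laurentCoeff_congr {f g : ℂ → ℂ} (h : Set.EqOn f g (Metric.sphere 0 1)) (n : ℤ) :
    laurentCoeff f n = laurentCoeff g n := by
  unfold laurentCoeff
  congr 2
  exact circleIntegral.integral_congr zero_le_one fun u hu => congrArg (· * u ^ (-n - 1)) (h hu)

theorem abs_laurentCoeff_le {f : ℂ → ℂ} {B : ℝ} (hB : ∀ u ∈ Metric.sphere (0 : ℂ) 1, ‖f u‖ ≤ B)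
    (n : ℤ) : |laurentCoeff f n| ≤ B := by
  refine (Complex.abs_re_le_norm _).trans ?_
  have := circleIntegral.norm_two_pi_i_inv_smul_integral_le_of_norm_le_const (c := 0) (R := 1)
    (f := fun u => f u * u ^ (-n - 1)) (C := B) zero_le_one fun z hz => by
      have hz1 : ‖z‖ = 1 := by simpa using hz
      rw [norm_mul, norm_zpow, hz1, one_zpow, mul_one]
      exact hB z hz
  simpa using this

theorem laurentCoeff_smul_add {f g : ℂ → ℂ} (hf : ContinuousOn f (Metric.sphere 0 1))
    (hg : ContinuousOn g (Metric.sphere 0 1)) (p r : ℝ) (s n : ℤ) :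
    laurentCoeff (fun u => p * f u + r * (u ^ s * g u)) n =
      p * laurentCoeff f n + r * laurentCoeff g (n - s) := by
  unfold laurentCoeff
  have e : (∮ u in C(0, 1), (p * f u + r * (u ^ s * g u)) * u ^ (-n - 1)) =
      (∮ u in C(0, 1), (p * (f u * u ^ (-n - 1)) + r * (g u * u ^ (-(n - s) - 1)))) := by
    refine circleIntegral.integral_congr zero_le_one fun u hu => ?_
    have hu0 := ne_zero_of_mem_sphere zero_lt_one hu
    have : u ^ (-(n - s) - 1) = u ^ s * u ^ (-n - 1) := by
      rw [← zpow_add₀ hu0]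
      congr 1
      ring
    simp only [this]
    ring
  have hF := (continuousOn_mul_zpow zero_lt_one hf (-n - 1)).circleIntegrable zero_le_one
  have hG := (continuousOn_mul_zpow zero_lt_one hg (-(n - s) - 1)).circleIntegrable zero_le_one
  have hadd := circleIntegral.integral_add (hF.const_smul (a := (p : ℂ)))
    (hG.const_smul (a := (r : ℂ)))
  simp only [Pi.smul_apply, smul_eq_mul] at hadd
  rw [e, hadd, circleIntegral.integral_const_mul,
    circleIntegral.integral_const_mul]
  simp only [mul_add, mul_left_comm _ (p : ℂ), mul_left_comm _ (r : ℂ), Complex.add_re,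
    Complex.re_ofReal_mul]

theorem tendsto_laurentCoeff {F : ℕ → ℂ → ℂ} {f : ℂ → ℂ} {B : ℝ}
    (hF : ∀ᶠ M in Filter.atTop, ContinuousOn (F M) (Metric.sphere 0 1))
    (hB : ∀ᶠ M in Filter.atTop, ∀ u ∈ Metric.sphere (0 : ℂ) 1, ‖F M u‖ ≤ B)
    (h : ∀ u ∈ Metric.sphere (0 : ℂ) 1, Filter.Tendsto (fun M => F M u) Filter.atTop (nhds (f u)))
    (n : ℤ) :
    Filter.Tendsto (fun M => laurentCoeff (F M) n) Filter.atTop (nhds (laurentCoeff f n)) := by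
  unfold laurentCoeff
  refine (Complex.continuous_re.tendsto _).comp (Filter.Tendsto.const_mul _ ?_)
  have hm : ∀ θ : ℝ, circleMap 0 1 θ ∈ Metric.sphere (0 : ℂ) 1 := fun θ =>
    circleMap_mem_sphere 0 zero_le_one θ
  refine intervalIntegral.tendsto_integral_filter_of_dominated_convergence (fun _ => B) ?_ ?_
    intervalIntegrable_const (Filter.Eventually.of_forall fun θ _ => ?_)
  · filter_upwards [hF] with M hM
    refine Continuous.aestronglyMeasurable ?_
    have h1 : Continuous fun θ : ℝ => F M (circleMap 0 1 θ) * circleMap 0 1 θ ^ (-n - 1) :=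
      (continuousOn_mul_zpow zero_lt_one hM (-n - 1)).comp_continuous (continuous_circleMap 0 1) hm
    simp only [deriv_circleMap]
    exact ((continuous_circleMap 0 1).mul continuous_const).smul h1
  · filter_upwards [hB] with M hM
    refine Filter.Eventually.of_forall fun θ _ => ?_
    simpa using hM _ (hm θ)
  · exact ((h _ (hm θ)).mul_const _).const_smul _

theorem laurentCoeff_one : laurentCoeff (fun _ => 1) = fun n => if n = 0 then 1 else 0 := by
  funext n
  unfold laurentCoeff
  split_ifs with h
  · subst h
    have := circleIntegral.integral_sub_center_inv (0 : ℂ) (one_ne_zero (α := ℝ))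
    simp only [sub_zero] at this
    simp only [one_mul, neg_zero, zero_sub, zpow_neg_one, this]
    rw [inv_mul_cancel₀ (by simp [Real.pi_ne_zero])]
    simp
  · have := circleIntegral.integral_sub_zpow_of_ne (n := -n - 1) (by omega) (0 : ℂ) 0 1
    simp only [sub_zero] at this
    simp [this]

/-! ### Functions on the circle with totally positive Laurent coefficients -/

/-- Continuous functions on the unit circle bounded by one, with totally positive coefficients. -/
structure IsPositiveSymbol (f : ℂ → ℂ) : Prop where
  continuousOn : ContinuousOn f (Metric.sphere 0 1)
  norm_le_one : ∀ u ∈ Metric.sphere (0 : ℂ) 1, ‖f u‖ ≤ 1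
  toeplitzNonneg : ToeplitzNonneg (laurentCoeff f)

theorem isPositiveSymbol_one : IsPositiveSymbol fun _ => 1 :=
  ⟨continuousOn_const, fun _ _ => by simp, laurentCoeff_one ▸ toeplitzNonneg_single⟩

theorem IsPositiveSymbol.of_tendsto {F : ℕ → ℂ → ℂ} {f : ℂ → ℂ}
    (hF : ∀ᶠ M in Filter.atTop, IsPositiveSymbol (F M))
    (hf : ContinuousOn f (Metric.sphere 0 1))
    (h : ∀ u ∈ Metric.sphere (0 : ℂ) 1,
      Filter.Tendsto (fun M => F M u) Filter.atTop (nhds (f u))) : IsPositiveSymbol f where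
  continuousOn := hf
  norm_le_one u hu := le_of_tendsto (h u hu).norm (hF.mono fun _ hM => hM.norm_le_one u hu)
  toeplitzNonneg := ToeplitzNonneg.of_tendsto (hF.mono fun _ hM => hM.toeplitzNonneg) fun n =>
    tendsto_laurentCoeff (hF.mono fun _ hM => hM.continuousOn)
      (hF.mono fun _ hM => hM.norm_le_one) h n

theorem IsPositiveSymbol.congr {f g : ℂ → ℂ} (hf : IsPositiveSymbol f)
    (h : Set.EqOn g f (Metric.sphere 0 1)) : IsPositiveSymbol g where
  continuousOn := hf.continuousOn.congr h
  norm_le_one u hu := h hu ▸ hf.norm_le_one u hu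
  toeplitzNonneg := by
    rw [show laurentCoeff g = laurentCoeff f from funext (laurentCoeff_congr h)]
    exact hf.toeplitzNonneg

theorem norm_one_add_mul_sub_one_le {b : ℝ} (h0 : 0 ≤ b) (h1 : b ≤ 1) {u : ℂ} (hu : ‖u‖ = 1) :
    ‖1 + b * (u - 1)‖ ≤ 1 := by
  rw [show 1 + b * (u - 1) = ((1 - b : ℝ) : ℂ) + b * u by push_cast; ring]
  refine (norm_add_le _ _).trans ?_
  rw [norm_mul, hu, Complex.norm_real, Complex.norm_real, Real.norm_of_nonneg h0,
    Real.norm_of_nonneg (sub_nonneg.2 h1)]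
  linarith

theorem IsPositiveSymbol.mul_beta {f : ℂ → ℂ} (hf : IsPositiveSymbol f) {b : ℝ} (h0 : 0 ≤ b)
    (h1 : b ≤ 1) : IsPositiveSymbol fun u => (1 + b * (u - 1)) * f u where
  continuousOn := by
    have := hf.continuousOn
    fun_prop
  norm_le_one u hu := by
    rw [norm_mul]
    exact mul_le_one₀ (norm_one_add_mul_sub_one_le h0 h1 (by simpa using hu)) (norm_nonneg _)
      (hf.norm_le_one u hu)
  toeplitzNonneg := by
    have e : laurentCoeff (fun u => (1 + b * (u - 1)) * f u) = fun n =>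
        (1 - b) * laurentCoeff f n + b * laurentCoeff f (n - 1) := by
      funext n
      rw [← laurentCoeff_smul_add hf.continuousOn hf.continuousOn]
      refine laurentCoeff_congr (fun u _ => ?_) n
      simp only [zpow_one]
      push_cast
      ring
    rw [e]
    exact hf.toeplitzNonneg.add_shift (sub_nonneg.2 h1) h0

/-- The factor is (1 - b) + b u⁻¹, that is, u⁻¹ times b + (1 - b) u: a shift of the coefficients
followed by `add_shift`. -/
theorem IsPositiveSymbol.mul_beta_inv {f : ℂ → ℂ} (hf : IsPositiveSymbol f) {b : ℝ} (h0 : 0 ≤ b)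
    (h1 : b ≤ 1) : IsPositiveSymbol fun u => (1 + b * (u⁻¹ - 1)) * f u where
  continuousOn := by
    have := hf.continuousOn
    refine ContinuousOn.mul ?_ this
    refine continuousOn_const.add (continuousOn_const.mul (ContinuousOn.sub ?_ continuousOn_const))
    exact continuousOn_id.inv₀ fun u hu => ne_zero_of_mem_sphere zero_lt_one hu
  norm_le_one u hu := by
    rw [norm_mul]
    exact mul_le_one₀ (norm_one_add_mul_sub_one_le h0 h1 (by
      rw [norm_inv]; simpa using hu)) (norm_nonneg _) (hf.norm_le_one u hu)
  toeplitzNonneg := by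
    have e : laurentCoeff (fun u => (1 + b * (u⁻¹ - 1)) * f u) = fun n =>
        b * laurentCoeff f (n + 1) + (1 - b) * laurentCoeff f (n - 1 + 1) := by
      funext n
      have := laurentCoeff_smul_add hf.continuousOn hf.continuousOn (1 - b) b (-1) n
      rw [sub_neg_eq_add] at this
      rw [sub_add_cancel, add_comm, ← this]
      refine laurentCoeff_congr (fun u _ => ?_) n
      simp only [zpow_neg_one]
      push_cast
      ring
    rw [e]
    exact (hf.toeplitzNonneg.shift 1).add_shift h0 (sub_nonneg.2 h1)

theorem le_norm_one_sub_mul_sub_one {a : ℝ} (h0 : 0 ≤ a) (u : ℂ) :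
    1 + a - a * ‖u‖ ≤ ‖1 - a * (u - 1)‖ := by
  rw [show 1 - a * (u - 1) = ((1 + a : ℝ) : ℂ) - a * u by push_cast; ring]
  refine le_trans (le_of_eq ?_) (norm_sub_norm_le _ _)
  rw [norm_mul, Complex.norm_real, Complex.norm_real, Real.norm_of_nonneg h0,
    Real.norm_of_nonneg (by linarith)]

/-- The coefficients c of the quotient satisfy (1 + a) c_n - a c_{n-1} = f_n, a recurrence with
ratio a/(1 + a) < 1. They are bounded because the denominator has modulus at least one on the
circle. -/
theorem IsPositiveSymbol.div_alpha {f : ℂ → ℂ} (hf : IsPositiveSymbol f) {a : ℝ} (h0 : 0 ≤ a) :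
    IsPositiveSymbol fun u => f u / (1 - a * (u - 1)) := by
  have hn : ∀ u ∈ Metric.sphere (0 : ℂ) 1, 1 ≤ ‖1 - a * (u - 1)‖ := fun u hu => by
    have := le_norm_one_sub_mul_sub_one h0 u
    have h1 : ‖u‖ = 1 := by simpa using hu
    rw [h1] at this
    linarith
  have hne : ∀ u ∈ Metric.sphere (0 : ℂ) 1, 1 - a * (u - 1) ≠ 0 := fun u hu h => by
    have := hn u hu
    rw [h, norm_zero] at this
    linarith
  have hc : ContinuousOn (fun u => f u / (1 - a * (u - 1))) (Metric.sphere 0 1) :=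
    hf.continuousOn.div (by fun_prop) hne
  have hb : ∀ u ∈ Metric.sphere (0 : ℂ) 1, ‖f u / (1 - a * (u - 1))‖ ≤ 1 := fun u hu => by
    rw [norm_div]
    exact div_le_one_of_le₀ ((hf.norm_le_one u hu).trans (hn u hu)) (norm_nonneg _)
  refine ⟨hc, hb, ?_⟩
  have h1 : 0 < 1 + a := by linarith
  -- Taking r = 0 serves only to rescale by (1 + a)⁻¹.
  have hs : ToeplitzNonneg fun n => (1 + a)⁻¹ * laurentCoeff f n + 0 * laurentCoeff f (n - 1) :=
    hf.toeplitzNonneg.add_shift (inv_nonneg.2 h1.le) le_rfl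
  refine hs.of_recurrence (s := a / (1 + a)) (div_nonneg h0 h1.le)
    ((div_lt_one h1).2 (by linarith)) (fun n => ?_) (abs_laurentCoeff_le hb)
  have := laurentCoeff_smul_add hc hc (1 + a) (-a) 1 n
  have e : laurentCoeff (fun u => ((1 + a : ℝ) : ℂ) * (f u / (1 - a * (u - 1))) +
      ((-a : ℝ) : ℂ) * (u ^ (1 : ℤ) * (f u / (1 - a * (u - 1))))) n = laurentCoeff f n := by
    refine laurentCoeff_congr (fun u hu => ?_) n
    have := hne u hu
    simp only [zpow_one]
    push_cast
    field_simp
    ring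
  rw [e] at this
  rw [this]
  field_simp
  ring

theorem tendsto_one_add_div_mul_pow (c : ℝ) (z : ℂ) :
    Filter.Tendsto (fun M : ℕ => (1 + ((c / M : ℝ) : ℂ) * z) ^ M) Filter.atTop
      (nhds (Complex.exp (c * z))) := by
  refine (Complex.tendsto_one_add_div_pow_exp (c * z)).congr fun M => ?_
  push_cast
  rw [div_mul_eq_mul_div]

theorem eventually_div_mem_Icc {c : ℝ} (hc : 0 ≤ c) :
    ∀ᶠ M : ℕ in Filter.atTop, 0 ≤ c / M ∧ c / M ≤ 1 := by
  filter_upwards [Filter.eventually_ge_atTop ⌈c⌉₊] with M hM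
  exact ⟨by positivity, div_le_one_of_le₀ (Nat.ceil_le.1 hM) (Nat.cast_nonneg M)⟩

/-- The exponential is the limit of (1 + (c/M)(u - 1))^M, a power of an admissible β-factor once c/M
≤ 1. -/
theorem IsPositiveSymbol.mul_exp {f : ℂ → ℂ} (hf : IsPositiveSymbol f) {c : ℝ} (hc : 0 ≤ c) :
    IsPositiveSymbol fun u => Complex.exp (c * (u - 1)) * f u := by
  refine IsPositiveSymbol.of_tendsto
    (F := fun M u => (1 + ((c / M : ℝ) : ℂ) * (u - 1)) ^ M * f u) ?_ ?_ fun u _ =>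
      (tendsto_one_add_div_mul_pow c (u - 1)).mul_const _
  · filter_upwards [eventually_div_mem_Icc hc] with M hM
    generalize c / (M : ℝ) = b at hM
    induction M with
    | zero => simpa using hf
    | succ M ih => simpa only [pow_succ', mul_assoc] using ih.mul_beta hM.1 hM.2
  · have := hf.continuousOn
    fun_prop

theorem IsPositiveSymbol.mul_exp_inv {f : ℂ → ℂ} (hf : IsPositiveSymbol f) {c : ℝ} (hc : 0 ≤ c) :
    IsPositiveSymbol fun u => Complex.exp (c * (u⁻¹ - 1)) * f u := by
  refine IsPositiveSymbol.of_tendsto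
    (F := fun M u => (1 + ((c / M : ℝ) : ℂ) * (u⁻¹ - 1)) ^ M * f u) ?_ ?_ fun u _ =>
      (tendsto_one_add_div_mul_pow c (u⁻¹ - 1)).mul_const _
  · filter_upwards [eventually_div_mem_Icc hc] with M hM
    generalize c / (M : ℝ) = b at hM
    induction M with
    | zero => simpa using hf
    | succ M ih => simpa only [pow_succ', mul_assoc] using ih.mul_beta_inv hM.1 hM.2
  · refine ContinuousOn.mul (Complex.continuous_exp.comp_continuousOn ?_) hf.continuousOn
    refine continuousOn_const.mul (ContinuousOn.sub ?_ continuousOn_const)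
    exact continuousOn_id.inv₀ fun u hu => ne_zero_of_mem_sphere zero_lt_one hu

/-! ### Analyticity of the generating function -/

theorem psi_eq_laurentCoeff (ρ : Specialization) : psi ρ = laurentCoeff (genFun ρ) := rfl

namespace Specialization

/-- The `i`-th factor of the generating function. -/
noncomputable def factor (ρ : Specialization) (i : ℕ) (u : ℂ) : ℂ :=
  (1 + ρ.βp i * (u - 1)) / (1 - ρ.αp i * (u - 1)) *
    ((1 + ρ.βm i * (u⁻¹ - 1)) / (1 - ρ.αm i * (u⁻¹ - 1)))

/-- The generating function is analytic in the punctured disc of this radius. -/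
noncomputable def outerRadius (ρ : Specialization) : ℝ := 1 + 1 / (2 * ρ.αp 0 + 2)

theorem one_lt_outerRadius (ρ : Specialization) : 1 < ρ.outerRadius := by
  have := ρ.αp_nonneg 0
  unfold outerRadius
  have : 0 < 1 / (2 * ρ.αp 0 + 2) := by positivity
  linarith

theorem outerRadius_le_two (ρ : Specialization) : ρ.outerRadius ≤ 2 := by
  have := ρ.αp_nonneg 0
  unfold outerRadius
  have : 1 / (2 * ρ.αp 0 + 2) ≤ 1 := (div_le_one (by linarith)).2 (by linarith)
  linarith

/-- An annulus on which the generating function is analytic. -/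
def annulus (ρ : Specialization) (r : ℝ) : Set ℂ := {u | r < ‖u‖ ∧ ‖u‖ < ρ.outerRadius}

theorem isOpen_annulus (ρ : Specialization) (r : ℝ) : IsOpen (ρ.annulus r) :=
  (isOpen_lt continuous_const continuous_norm).inter (isOpen_lt continuous_norm continuous_const)

theorem ne_zero_of_mem_annulus {ρ : Specialization} {r : ℝ} (hr : 0 < r) {u : ℂ}
    (hu : u ∈ ρ.annulus r) : u ≠ 0 := norm_pos_iff.1 (hr.trans hu.1)

/-- The poles 1 + 1/α_i lie beyond `outerRadius`, which is chosen so that α_i(|u| - 1) ≤ α_0/(2α_0 +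
2) ≤ 1/2, uniformly in i. -/
theorem half_le_norm_alpha_denom (ρ : Specialization) (i : ℕ) {u : ℂ}
    (hu : ‖u‖ ≤ ρ.outerRadius) : 1 / 2 ≤ ‖1 - ρ.αp i * (u - 1)‖ := by
  refine le_trans ?_ (le_norm_one_sub_mul_sub_one (ρ.αp_nonneg i) u)
  have h0 := ρ.αp_nonneg i
  have h1 := ρ.αp_anti (Nat.zero_le i)
  have h2 : ρ.αp i * (‖u‖ - 1) ≤ ρ.αp i * (1 / (2 * ρ.αp 0 + 2)) :=
    mul_le_mul_of_nonneg_left (by unfold outerRadius at hu; linarith) h0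
  have h3 : ρ.αp i * (1 / (2 * ρ.αp 0 + 2)) ≤ 1 / 2 := by
    rw [mul_one_div, div_le_div_iff₀ (by linarith) (by norm_num)]
    linarith
  linarith

theorem alpha_denom_ne_zero (ρ : Specialization) (i : ℕ) {u : ℂ}
    (hu : ‖u‖ ≤ ρ.outerRadius) : 1 - ρ.αp i * (u - 1) ≠ 0 := fun h => by
  have := ρ.half_le_norm_alpha_denom i hu
  rw [h, norm_zero] at this
  linarith

theorem factor_eq {ρ : Specialization} (hρ : ∀ i, ρ.αm i = 0) (i : ℕ) (u : ℂ) :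
    ρ.factor i u = (1 + ρ.βp i * (u - 1)) / (1 - ρ.αp i * (u - 1)) *
      (1 + ρ.βm i * (u⁻¹ - 1)) := by
  simp [factor, hρ i]

theorem differentiableOn_factor {ρ : Specialization} (hρ : ∀ i, ρ.αm i = 0) (i : ℕ) {r : ℝ}
    (hr : 0 < r) : DifferentiableOn ℂ (ρ.factor i) (ρ.annulus r) := by
  intro u hu
  have h0 := ne_zero_of_mem_annulus hr hu
  have h1 := ρ.alpha_denom_ne_zero i hu.2.le
  rw [show ρ.factor i = _ from funext (factor_eq hρ i)]
  refine DifferentiableAt.differentiableWithinAt ?_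
  fun_prop (disch := assumption)

/-- With |u - 1| ≤ 3, |u⁻¹ - 1| ≤ r⁻¹ + 1 and β^+ ≤ 1 in the cross term, the numerator is at most
4(r⁻¹ + 1) times the sum of the parameters; the denominator is at least 1/2, whence 8. -/
theorem norm_factor_sub_one_le {ρ : Specialization} (hρ : ∀ i, ρ.αm i = 0) (i : ℕ) {r : ℝ}
    (hr : 0 < r) {u : ℂ} (hu : u ∈ ρ.annulus r) :
    ‖ρ.factor i u - 1‖ ≤ 8 * (r⁻¹ + 1) * (ρ.αp i + ρ.βp i + ρ.βm i) := by
  have hd := ρ.half_le_norm_alpha_denom i hu.2.le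
  have hd0 := ρ.alpha_denom_ne_zero i hu.2.le
  have hx : ‖u - 1‖ ≤ 3 := by
    refine (norm_sub_le _ _).trans ?_
    rw [norm_one]
    linarith [hu.2, ρ.outerRadius_le_two]
  have hy : ‖u⁻¹ - 1‖ ≤ r⁻¹ + 1 := by
    refine (norm_sub_le _ _).trans ?_
    rw [norm_one, norm_inv]
    linarith [inv_anti₀ hr hu.1.le]
  have e : ρ.factor i u - 1 = (ρ.βp i * (u - 1) + ρ.βm i * (u⁻¹ - 1) +
      ρ.βp i * (u - 1) * (ρ.βm i * (u⁻¹ - 1)) + ρ.αp i * (u - 1)) /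
        (1 - ρ.αp i * (u - 1)) := by
    rw [factor_eq hρ, div_mul_eq_mul_div, div_sub_one hd0]
    congr 1
    ring
  have ha := ρ.αp_nonneg i
  have hb := ρ.βp_nonneg i
  have hb' := ρ.βm_nonneg i
  have hb1 := ρ.βp_le_one i
  have hr' : 0 < r⁻¹ := inv_pos.2 hr
  have n1 : ‖(ρ.βp i : ℂ) * (u - 1)‖ ≤ ρ.βp i * 3 := by
    rw [norm_mul, Complex.norm_real, Real.norm_of_nonneg hb]
    gcongr
  have n2 : ‖(ρ.βm i : ℂ) * (u⁻¹ - 1)‖ ≤ ρ.βm i * (r⁻¹ + 1) := by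
    rw [norm_mul, Complex.norm_real, Real.norm_of_nonneg hb']
    gcongr
  have n3 : ‖(ρ.αp i : ℂ) * (u - 1)‖ ≤ ρ.αp i * 3 := by
    rw [norm_mul, Complex.norm_real, Real.norm_of_nonneg ha]
    gcongr
  have n4 : ‖(ρ.βp i : ℂ) * (u - 1) * (ρ.βm i * (u⁻¹ - 1))‖ ≤ 3 * (ρ.βm i * (r⁻¹ + 1)) := by
    rw [norm_mul]
    exact mul_le_mul (n1.trans (by linarith)) n2 (norm_nonneg _) (by norm_num)
  rw [e, norm_div, div_le_iff₀ (by linarith)]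
  have hnum := norm_add₄_le (a := (ρ.βp i : ℂ) * (u - 1)) (b := ρ.βm i * (u⁻¹ - 1))
    (c := ρ.βp i * (u - 1) * (ρ.βm i * (u⁻¹ - 1))) (d := ρ.αp i * (u - 1))
  have hK : 0 ≤ 8 * (r⁻¹ + 1) * (ρ.αp i + ρ.βp i + ρ.βm i) := by positivity
  have h5 := mul_le_mul_of_nonneg_left hd hK
  have h6 : 0 ≤ r⁻¹ * ρ.αp i := by positivity
  have h7 : 0 ≤ r⁻¹ * ρ.βp i := by positivity
  refine le_trans ?_ h5
  nlinarith

theorem hasProdLocallyUniformlyOn_factor {ρ : Specialization} (hρ : ∀ i, ρ.αm i = 0) {r : ℝ}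
    (hr : 0 < r) :
    HasProdLocallyUniformlyOn ρ.factor (fun u => ∏' i, ρ.factor i u) (ρ.annulus r) := by
  have hu : Summable fun i => 8 * (r⁻¹ + 1) * (ρ.αp i + ρ.βp i + ρ.βm i) :=
    ((ρ.αp_summable.add ρ.βp_summable).add ρ.βm_summable).mul_left _
  have := hu.hasProdLocallyUniformlyOn_nat_one_add (f := fun i u => ρ.factor i u - 1)
    (ρ.isOpen_annulus r)
    (Filter.Eventually.of_forall fun i u hu => norm_factor_sub_one_le hρ i hr hu)
    fun i => (differentiableOn_factor hρ i hr).continuousOn.sub continuousOn_const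
  simpa only [add_sub_cancel] using this

theorem hasProd_factor {ρ : Specialization} (hρ : ∀ i, ρ.αm i = 0) {u : ℂ} (hu0 : u ≠ 0)
    (hu : ‖u‖ < ρ.outerRadius) : HasProd (fun i => ρ.factor i u) (∏' i, ρ.factor i u) :=
  (hasProdLocallyUniformlyOn_factor hρ (half_pos (norm_pos_iff.2 hu0))).hasProd
    ⟨half_lt_self (norm_pos_iff.2 hu0), hu⟩

theorem differentiableOn_genFun {ρ : Specialization} (hρ : ∀ i, ρ.αm i = 0) {r : ℝ}
    (hr : 0 < r) : DifferentiableOn ℂ (genFun ρ) (ρ.annulus r) := by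
  have h1 : DifferentiableOn ℂ (fun u => ∏' i, ρ.factor i u) (ρ.annulus r) :=
    (hasProdLocallyUniformlyOn_factor hρ hr).differentiableOn
      (Filter.Eventually.of_forall fun s =>
        DifferentiableOn.fun_finsetProd fun i _ => differentiableOn_factor hρ i hr)
      (ρ.isOpen_annulus r)
  refine DifferentiableOn.mul (fun u hu => ?_) h1
  have h0 := ne_zero_of_mem_annulus hr hu
  refine DifferentiableAt.differentiableWithinAt ?_
  fun_prop (disch := assumption)

theorem continuousOn_genFun {ρ : Specialization} (hρ : ∀ i, ρ.αm i = 0) {r : ℝ}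
    (hr : 0 < r) (hr1 : r < ρ.outerRadius) :
    ContinuousOn (genFun ρ) (Metric.sphere 0 r) :=
  (differentiableOn_genFun hρ (half_pos hr)).continuousOn.mono fun u hu => by
    have : ‖u‖ = r := by simpa using hu
    exact ⟨by linarith, by linarith⟩

/-- The constant 1 is a positive symbol and every α-, β- and exponential factor preserves the
property. Partial products are bounded by one on the circle and converge pointwise, so the limit
inherits it. -/
theorem isPositiveSymbol_genFun {ρ : Specialization} (hρ : ∀ i, ρ.αm i = 0) :
    IsPositiveSymbol (genFun ρ) := by
  have hprod : ∀ M : ℕ, IsPositiveSymbol fun u => ∏ i ∈ Finset.range M, ρ.factor i u := by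
    intro M
    induction M with
    | zero => simpa using isPositiveSymbol_one
    | succ M ih =>
      refine (((ih.mul_beta (ρ.βp_nonneg M) (ρ.βp_le_one M)).div_alpha
        (ρ.αp_nonneg M)).mul_beta_inv (ρ.βm_nonneg M) (ρ.βm_le_one M)).congr fun u _ => ?_
      simp only [Finset.prod_range_succ, factor_eq hρ]
      ring
  refine IsPositiveSymbol.of_tendsto
    (F := fun M u => Complex.exp (ρ.γp * (u - 1)) * (Complex.exp (ρ.γm * (u⁻¹ - 1)) *
      ∏ i ∈ Finset.range M, ρ.factor i u))
    (Filter.Eventually.of_forall fun M =>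
      ((hprod M).mul_exp_inv ρ.γm_nonneg).mul_exp ρ.γp_nonneg)
    (continuousOn_genFun hρ zero_lt_one ρ.one_lt_outerRadius) fun u hu => ?_
  have h1 : ‖u‖ = 1 := by simpa using hu
  have := (hasProd_factor hρ (ne_zero_of_mem_sphere zero_lt_one hu)
    (h1 ▸ ρ.one_lt_outerRadius)).tendsto_prod_nat
  simp only [genFun, Complex.exp_add, mul_assoc]
  exact (this.const_mul _).const_mul _

theorem psi_nonneg {ρ : Specialization} (hρ : ∀ i, ρ.αm i = 0) (n : ℤ) : 0 ≤ psi ρ n := by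
  have := (isPositiveSymbol_genFun hρ).toeplitzNonneg 1 (fun _ => n)
    (Subsingleton.strictMono _)
  simpa [← psi_eq_laurentCoeff] using this

theorem schurSpec_nonneg {ρ : Specialization} (hρ : ∀ i, ρ.αm i = 0) {N : ℕ} {l : Fin N → ℤ}
    (hl : Antitone l) : 0 ≤ schurSpec ρ l :=
  (isPositiveSymbol_genFun hρ).toeplitzNonneg.schur_nonneg hl

/-! ### Contour shifts and decay of the Laurent coefficients. -/

/-- With α^- = 0 the origin is the only possible singularity of Ψ inside the unit disc, so the
contour can be shrunk to any radius, in particular to q. Nonzero α^- would put poles in the way. -/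
theorem circleIntegral_genFun_eq {ρ : Specialization} (hρ : ∀ i, ρ.αm i = 0) (k : ℤ) {r : ℝ}
    (hr : 0 < r) (hr1 : r < ρ.outerRadius) :
    (∮ u in C(0, r), genFun ρ u * u ^ k) = ∮ u in C(0, 1), genFun ρ u * u ^ k := by
  have hd : ∀ s : ℝ, 0 < s →
      DifferentiableOn ℂ (fun u => genFun ρ u * u ^ k) (ρ.annulus s) := fun s hs =>
    (differentiableOn_genFun hρ hs).mul (differentiableOn_id.zpow (Or.inl fun u hu =>
      ne_zero_of_mem_annulus hs hu))
  have key : ∀ s t : ℝ, 0 < s → s ≤ t → t < ρ.outerRadius →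
      (∮ u in C(0, t), genFun ρ u * u ^ k) = ∮ u in C(0, s), genFun ρ u * u ^ k := by
    intro s t hs hst ht
    have hs2 := hd (s / 2) (half_pos hs)
    refine Complex.circleIntegral_eq_of_differentiable_on_annulus_off_countable hs hst
      Set.countable_empty (hs2.continuousOn.mono ?_) fun z hz =>
        hs2.differentiableAt ((ρ.isOpen_annulus _).mem_nhds ?_)
    · rintro z ⟨h1, h2⟩
      simp only [Metric.mem_closedBall, dist_zero_right, Metric.mem_ball, not_lt] at h1 h2
      exact ⟨by linarith, by linarith⟩
    · obtain ⟨⟨h1, h2⟩, -⟩ := hz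
      simp only [Metric.mem_closedBall, dist_zero_right, Metric.mem_ball, not_le] at h1 h2
      exact ⟨by linarith, by linarith⟩
  rcases le_total r 1 with h | h
  · exact (key r 1 hr h ρ.one_lt_outerRadius).symm
  · exact key 1 r zero_lt_one h hr1

/-- The complex Laurent coefficient whose real part is `psi`. -/
noncomputable def coeff (ρ : Specialization) (n : ℤ) : ℂ :=
  (2 * Real.pi * Complex.I)⁻¹ * ∮ u in C(0, 1), genFun ρ u * u ^ (-n - 1)

theorem exists_norm_coeff_le {ρ : Specialization} (hρ : ∀ i, ρ.αm i = 0) {r : ℝ}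
    (hr : 0 < r) (hr1 : r < ρ.outerRadius) :
    ∃ C : ℝ, 0 ≤ C ∧ ∀ n, ‖ρ.coeff n‖ ≤ C * r ^ (-n) := by
  obtain ⟨C, hC⟩ := (isCompact_sphere (0 : ℂ) r).exists_bound_of_continuousOn
    (continuousOn_genFun hρ hr hr1)
  refine ⟨max C 0, le_max_right _ _, fun n => ?_⟩
  rw [coeff, ← circleIntegral_genFun_eq hρ (-n - 1) hr hr1]
  have := circleIntegral.norm_two_pi_i_inv_smul_integral_le_of_norm_le_const (c := 0) (R := r)
    (f := fun u => genFun ρ u * u ^ (-n - 1)) (C := max C 0 * r ^ (-n - 1)) hr.le fun z hz => by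
      have hz1 : ‖z‖ = r := by simpa using hz
      rw [norm_mul, norm_zpow, hz1]
      exact mul_le_mul_of_nonneg_right ((hC z hz).trans (le_max_left _ _)) (zpow_pos hr _).le
  rw [smul_eq_mul] at this
  refine this.trans_eq ?_
  rw [zpow_sub_one₀ hr.ne']
  field_simp

/-- Cauchy estimates on two circles: a radius above 1 gives decay as n → +∞, and the radius x/2
beats x^n as n → -∞. -/
theorem summable_norm_coeff_mul_zpow {ρ : Specialization} (hρ : ∀ i, ρ.αm i = 0) {x : ℝ}
    (hx : 0 < x) (hx1 : x ≤ 1) : Summable fun n : ℤ => ‖ρ.coeff n‖ * x ^ n := by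
  refine Summable.of_nat_of_neg ?_ ?_
  · obtain ⟨R, hR1, hR⟩ := exists_between ρ.one_lt_outerRadius
    have hRp : 0 < R := by linarith
    obtain ⟨C, hC, h⟩ := exists_norm_coeff_le hρ hRp hR
    refine Summable.of_nonneg_of_le (fun n => by positivity) (fun n => ?_)
      ((summable_geometric_of_lt_one (r := R⁻¹) (by positivity)
        (inv_lt_one_of_one_lt₀ hR1)).mul_left C)
    calc ‖ρ.coeff n‖ * x ^ (n : ℤ) ≤ C * R ^ (-(n : ℤ)) * 1 := by
          refine mul_le_mul (h n) ?_ (by positivity) (by positivity)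
          rw [zpow_natCast]
          exact pow_le_one₀ hx.le hx1
      _ = C * R⁻¹ ^ n := by simp [zpow_neg]
  · obtain ⟨C, hC, h⟩ := exists_norm_coeff_le hρ (half_pos hx)
      (by linarith [ρ.one_lt_outerRadius])
    refine Summable.of_nonneg_of_le (fun n => by positivity) (fun n => ?_)
      ((summable_geometric_of_lt_one (r := (2 : ℝ)⁻¹) (by positivity) (by norm_num)).mul_left C)
    calc ‖ρ.coeff (-n)‖ * x ^ (-(n : ℤ)) ≤ C * (x / 2) ^ (- -(n : ℤ)) * x ^ (-(n : ℤ)) := by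
          gcongr
          exact h _
      _ = C * 2⁻¹ ^ n := by
          rw [neg_neg, zpow_natCast, zpow_neg, zpow_natCast, div_eq_mul_inv, mul_pow, mul_assoc,
            mul_right_comm, mul_inv_cancel₀ (pow_pos hx n).ne', one_mul]

theorem summable_psi_mul_zpow {ρ : Specialization} (hρ : ∀ i, ρ.αm i = 0) {x : ℝ} (hx : 0 < x)
    (hx1 : x ≤ 1) : Summable fun n : ℤ => psi ρ n * x ^ n :=
  Summable.of_nonneg_of_le (fun n => mul_nonneg (psi_nonneg hρ n) (zpow_pos hx n).le)
    (fun n => mul_le_mul_of_nonneg_right ((le_abs_self _).trans (Complex.abs_re_le_norm _))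
      (zpow_pos hx n).le) (summable_norm_coeff_mul_zpow hρ hx hx1)

end Specialization

theorem prod_zpow_eq_zpow_sum {ι : Type*} (s : Finset ι) {q : ℝ} (hq : q ≠ 0) (f : ι → ℤ) :
    ∏ i ∈ s, q ^ f i = q ^ ∑ i ∈ s, f i := by
  induction s using Finset.cons_induction with
  | empty => simp
  | cons i s hi ih => rw [Finset.prod_cons, Finset.sum_cons, ih, zpow_add₀ hq]

namespace Specialization

theorem genFun_one (ρ : Specialization) : genFun ρ 1 = 1 := by
  simp [genFun]

/-- The coefficients of the generating function sum to its value at one. -/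
theorem hasSum_psi {ρ : Specialization} (hρ : ∀ i, ρ.αm i = 0) : HasSum (psi ρ) 1 := by
  have : Fact (0 < 2 * Real.pi) := ⟨Real.two_pi_pos⟩
  have hs : ∀ x : AddCircle (2 * Real.pi), (fourier 1 x : ℂ) ∈ Metric.sphere (0 : ℂ) 1 :=
    fun x => by
      rw [fourier_apply, mem_sphere_zero_iff_norm]
      exact Circle.norm_coe _
  -- The Laurent coefficients are the Fourier coefficients of θ ↦ Ψ(e^{iθ}). They are absolutely
  -- summable, so the Fourier series converges at θ = 0, where Ψ equals 1.
  let f : C(AddCircle (2 * Real.pi), ℂ) := ⟨fun x => genFun ρ (fourier 1 x),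
    (continuousOn_genFun hρ zero_lt_one ρ.one_lt_outerRadius).comp_continuous
      (map_continuous (fourier 1)) hs⟩
  have hcoef : ∀ n : ℤ, fourierCoeff f n = ρ.coeff n := by
    intro n
    have e : (∮ u in C(0, 1), genFun ρ u * u ^ (-n - 1)) =
        ∫ θ in (0 : ℝ)..2 * Real.pi, Complex.I *
          (fourier (-n) (θ : AddCircle (2 * Real.pi)) • f θ) := by
      refine intervalIntegral.integral_congr fun θ _ => ?_
      have h1 : (fourier 1 (θ : AddCircle (2 * Real.pi)) : ℂ) = circleMap 0 1 θ := by
        rw [fourier_coe_apply, circleMap]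
        simp only [Complex.ofReal_one, one_mul, zero_add, Int.cast_one, mul_one]
        congr 1
        push_cast
        have : (Real.pi : ℂ) ≠ 0 := by simp [Real.pi_ne_zero]
        field_simp
      have h2 : (fourier (-n) (θ : AddCircle (2 * Real.pi)) : ℂ) = circleMap 0 1 θ ^ (-n) := by
        rw [← h1, fourier_coe_apply, fourier_coe_apply, ← Complex.exp_int_mul]
        congr 1
        push_cast
        ring
      have h0 : circleMap 0 1 θ ≠ 0 := circleMap_ne_center one_ne_zero
      simp only [f, ContinuousMap.coe_mk, h1, h2, smul_eq_mul, deriv_circleMap]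
      rw [zpow_sub_one₀ h0]
      field_simp
    rw [coeff, e, intervalIntegral.integral_const_mul, fourierCoeff_eq_intervalIntegral f n 0,
      zero_add, Complex.real_smul]
    push_cast
    field_simp
  have hsum : Summable (fourierCoeff f) := by
    refine Summable.of_norm ?_
    simpa [hcoef] using summable_norm_coeff_mul_zpow hρ zero_lt_one le_rfl
  have h := has_pointwise_sum_fourier_series_of_summable hsum 0
  have h0 : f 0 = 1 := by
    simp only [f, ContinuousMap.coe_mk]
    rw [fourier_eval_zero, genFun_one]
  simp only [h0, fourier_eval_zero, smul_eq_mul, mul_one, hcoef] at h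
  exact Complex.hasSum_re h

theorem exists_psi_pos {ρ : Specialization} (hρ : ∀ i, ρ.αm i = 0) : ∃ n, 0 < psi ρ n := by
  by_contra! h
  have : psi ρ = fun _ => 0 := funext fun n => le_antisymm (h n) (psi_nonneg hρ n)
  have h1 := hasSum_psi hρ
  rw [this] at h1
  exact one_ne_zero (h1.unique hasSum_zero)

/-- The sum of the Laurent series at a point of the positive half-line. -/
theorem tsum_psi_mul_zpow_pos {ρ : Specialization} (hρ : ∀ i, ρ.αm i = 0) {x : ℝ} (hx : 0 < x)
    (hx1 : x ≤ 1) : 0 < ∑' n : ℤ, psi ρ n * x ^ n := by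
  obtain ⟨n, hn⟩ := exists_psi_pos hρ
  exact (summable_psi_mul_zpow hρ hx hx1).tsum_pos
    (fun n => mul_nonneg (psi_nonneg hρ n) (zpow_pos hx n).le) n (mul_pos hn (zpow_pos hx n))

/-! ### The modified specialization -/

/-- Rescaling u and dividing by the value at u = 1 restores the normalised form with a new
parameter. It is applied with c = q to β^+, and with c = q⁻¹ at u⁻¹ to β^-. -/
theorem beta_numer_mul {c b : ℝ} (h : 1 - b + b * c ≠ 0) (u : ℂ) :
    1 + (b : ℂ) * (c * u - 1) =
      (1 + b * (c - 1)) * (1 + ((b * c / (1 - b + b * c) : ℝ) : ℂ) * (u - 1)) := by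
  have h' : (1 - b + b * c : ℂ) ≠ 0 := by exact_mod_cast h
  push_cast
  field_simp
  ring

theorem alpha_denom_mul {c a : ℝ} (h : 1 + a - a * c ≠ 0) (u : ℂ) :
    1 - (a : ℂ) * (c * u - 1) =
      (1 - a * (c - 1)) * (1 - ((a * c / (1 + a - a * c) : ℝ) : ℂ) * (u - 1)) := by
  have h' : (1 + a - a * c : ℂ) ≠ 0 := by exact_mod_cast h
  push_cast
  field_simp
  ring

theorem factor_mul {ρ : Specialization} (hρ : ∀ i, ρ.αm i = 0) {q : ℝ} (hq : 0 < q) (hq1 : q < 1)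
    (i : ℕ) (u : ℂ) :
    ρ.factor i (q * u) = ρ.factor i q * (ρ.modify q hq hq1).factor i u := by
  have h1 := beta_numer_mul (mod_denom_pos hq (ρ.βp_nonneg i) (ρ.βp_le_one i)).ne' u
  have h2 := beta_numer_mul
    (mod_denom_pos (inv_pos.2 hq) (ρ.βm_nonneg i) (ρ.βm_le_one i)).ne' u⁻¹
  have h3 := alpha_denom_mul (zero_lt_one.trans_le (αmod_denom hq1 (ρ.αp_nonneg i))).ne' u
  rw [factor_eq hρ, factor_eq hρ, factor_eq (ρ := ρ.modify q hq hq1) (fun _ => rfl), mul_inv,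
    h1, ← Complex.ofReal_inv, h2, h3, mul_div_mul_comm]
  exact mul_mul_mul_comm _ _ _ _

theorem genFun_mul {ρ : Specialization} (hρ : ∀ i, ρ.αm i = 0) {q : ℝ} (hq : 0 < q) (hq1 : q < 1)
    {u : ℂ} (hu : ‖u‖ = 1) :
    genFun ρ (q * u) = genFun ρ q * genFun (ρ.modify q hq hq1) u := by
  have hu0 : u ≠ 0 := fun h => by simp [h] at hu
  have hq0 : (q : ℂ) ≠ 0 := by exact_mod_cast hq.ne'
  have hnq : ‖(q : ℂ)‖ < ρ.outerRadius := by
    rw [Complex.norm_real, Real.norm_of_nonneg hq.le]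
    exact hq1.trans ρ.one_lt_outerRadius
  have h1 := (hasProd_factor hρ hq0 hnq).mul
    (hasProd_factor (ρ := ρ.modify q hq hq1) (fun _ => rfl) hu0
      (hu ▸ (ρ.modify q hq hq1).one_lt_outerRadius))
  have h2 : ∏' i, ρ.factor i (q * u) =
      (∏' i, ρ.factor i q) * ∏' i, (ρ.modify q hq hq1).factor i u := by
    rw [← h1.tprod_eq]
    exact tprod_congr fun i => factor_mul hρ hq hq1 i u
  have h3 : Complex.exp (ρ.γp * (q * u - 1) + ρ.γm * ((q * u)⁻¹ - 1)) =
      Complex.exp (ρ.γp * (q - 1) + ρ.γm * ((q : ℂ)⁻¹ - 1)) *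
      Complex.exp ((ρ.modify q hq hq1).γp * (u - 1) + (ρ.modify q hq hq1).γm * (u⁻¹ - 1)) := by
    rw [← Complex.exp_add]
    congr 1
    simp only [modify]
    push_cast
    rw [mul_inv]
    ring
  change Complex.exp _ * ∏' i, ρ.factor i (q * u) = (Complex.exp _ * ∏' i, ρ.factor i q) *
    (Complex.exp _ * ∏' i, (ρ.modify q hq hq1).factor i u)
  rw [h2, h3]
  ring

theorem exists_genFun_eq_ofReal (ρ : Specialization) (q : ℝ) : ∃ g : ℝ, genFun ρ q = g := by
  have hf : ∀ i, ∃ t : ℝ, ρ.factor i q = t := fun i => ⟨(1 + ρ.βp i * (q - 1)) /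
    (1 - ρ.αp i * (q - 1)) * ((1 + ρ.βm i * (q⁻¹ - 1)) / (1 - ρ.αm i * (q⁻¹ - 1))), by
      simp [factor]⟩
  choose t ht using hf
  have hp : ∏' i, ρ.factor i q = ((∏' i, t i : ℝ) : ℂ) := by
    simp only [ht]
    -- The real part is a continuous left inverse of the embedding of ℝ, so no convergence of the
    -- product has to be checked.
    exact (Function.LeftInverse.map_tprod t (g := Complex.ofRealHom) Complex.continuous_ofReal
      Complex.continuous_re Complex.ofReal_re).symm
  refine ⟨Real.exp (ρ.γp * (q - 1) + ρ.γm * (q⁻¹ - 1)) * ∏' i, t i, ?_⟩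
  change Complex.exp _ * ∏' i, ρ.factor i q = _
  rw [hp]
  simp

theorem exists_psi_modify {ρ : Specialization} (hρ : ∀ i, ρ.αm i = 0) {q : ℝ} (hq : 0 < q)
    (hq1 : q < 1) : ∃ g : ℝ, 0 < g ∧ ∀ n, q ^ n * psi ρ n = g * psi (ρ.modify q hq hq1) n := by
  obtain ⟨g, hg⟩ := exists_genFun_eq_ofReal ρ q
  have hρ' : ∀ i, (ρ.modify q hq hq1).αm i = 0 := fun _ => rfl
  have hq0 : (q : ℂ) ≠ 0 := by exact_mod_cast hq.ne'
  have key : ∀ n, q ^ n * psi ρ n = g * psi (ρ.modify q hq hq1) n := by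
    intro n
    -- Substitute u = q v on the circle of radius q, then move that circle back to radius one.
    have e : (∮ u in C(0, q), genFun ρ u * u ^ (-n - 1)) =
        (q : ℂ) ^ (-n) * (g * ∮ u in C(0, 1), genFun (ρ.modify q hq hq1) u * u ^ (-n - 1)) := by
      rw [← circleIntegral.integral_const_mul, ← circleIntegral.integral_const_mul]
      refine intervalIntegral.integral_congr fun θ _ => ?_
      have h1 : circleMap 0 q θ = q * circleMap 0 1 θ := by simp [circleMap]
      have hn : ‖circleMap 0 1 θ‖ = 1 := by simp
      have h0 : circleMap 0 1 θ ≠ 0 := circleMap_ne_center one_ne_zero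
      simp only [deriv_circleMap, smul_eq_mul]
      rw [h1, genFun_mul hρ hq hq1 hn, hg, mul_zpow, zpow_sub_one₀ hq0]
      field_simp
    rw [circleIntegral_genFun_eq hρ _ hq (hq1.trans ρ.one_lt_outerRadius)] at e
    rw [psi, psi, e, ← Complex.re_ofReal_mul, ← Complex.re_ofReal_mul]
    congr 1
    push_cast
    rw [zpow_neg]
    have := zpow_ne_zero n hq0
    field_simp
  refine ⟨g, ?_, key⟩
  obtain ⟨n, hn⟩ := exists_psi_pos hρ
  -- The sign of g is read off from one positive coefficient instead of from the product defining
  -- Ψ(q).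
  have h1 : 0 < g * psi (ρ.modify q hq hq1) n := key n ▸ mul_pos (zpow_pos hq n) hn
  exact pos_of_mul_pos_left h1 (psi_nonneg hρ' n)

/-- Writing q^{l_i + j - i} = q^{l_i - i} q^j, the row and column factors multiply to q^{|l|}, while
each of the N rows gains one factor g. -/
theorem exists_schurSpec_modify {ρ : Specialization} (hρ : ∀ i, ρ.αm i = 0) {q : ℝ} (hq : 0 < q)
    (hq1 : q < 1) (N : ℕ) : ∃ g : ℝ, 0 < g ∧ ∀ l : Fin N → ℤ,
      q ^ (∑ k, l k) * schurSpec ρ l = g * schurSpec (ρ.modify q hq hq1) l := by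
  obtain ⟨g, hg, h⟩ := exists_psi_modify hρ hq hq1
  refine ⟨g ^ N, pow_pos hg N, fun l => ?_⟩
  have e1 : (Matrix.of fun i j : Fin N =>
      q ^ (l i - (i : ℕ)) * (q ^ (j : ℕ) * psi ρ (l i + (j : ℕ) - (i : ℕ)))).det =
      q ^ (∑ k, l k) * schurSpec ρ l := by
    have h1 := Matrix.det_mul_column (fun i : Fin N => q ^ (l i - (i : ℕ)))
      (Matrix.of fun i j : Fin N => q ^ (j : ℕ) * psi ρ (l i + (j : ℕ) - (i : ℕ)))
    have h2 := Matrix.det_mul_row (fun j : Fin N => q ^ (j : ℕ))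
      (Matrix.of fun i j : Fin N => psi ρ (l i + (j : ℕ) - (i : ℕ)))
    simp only [Matrix.of_apply] at h1 h2
    rw [h1, h2, ← mul_assoc, ← Finset.prod_mul_distrib, schurSpec]
    congr 1
    rw [← prod_zpow_eq_zpow_sum _ hq.ne']
    refine Finset.prod_congr rfl fun i _ => ?_
    rw [zpow_sub₀ hq.ne', zpow_natCast, div_mul_cancel₀ _ (pow_pos hq _).ne']
  have e2 : (Matrix.of fun i j : Fin N =>
      q ^ (l i - (i : ℕ)) * (q ^ (j : ℕ) * psi ρ (l i + (j : ℕ) - (i : ℕ)))) =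
      g • (Matrix.of fun i j : Fin N => psi (ρ.modify q hq hq1) (l i + (j : ℕ) - (i : ℕ))) := by
    ext i j
    simp only [Matrix.of_apply, Matrix.smul_apply, smul_eq_mul]
    rw [← h, ← mul_assoc, ← zpow_natCast, ← zpow_add₀ hq.ne']
    congr 2
    ring
  rw [← e1, e2, Matrix.det_smul, Fintype.card_fin, schurSpec]

end Specialization

/-! ### The branching identity for determinants -/

theorem hasSum_pi_prod {n : ℕ} {f : Fin n → ℤ → ℝ} {s : Fin n → ℝ}
    (h : ∀ i, HasSum (f i) (s i)) :
    HasSum (fun l : Fin n → ℤ => ∏ i, f i (l i)) (∏ i, s i) := by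
  induction n with
  | zero => simp [hasSum_unique]
  | succ n ih =>
    have h1 := ih fun i => h i.succ
    have hs : Summable fun p : ℤ × (Fin n → ℤ) => f 0 p.1 * ∏ i : Fin n, f i.succ (p.2 i) :=
      summable_mul_of_summable_norm (f := f 0)
        (g := fun l : Fin n → ℤ => ∏ i : Fin n, f i.succ (l i)) (h 0).summable.norm
        h1.summable.norm
    have h2 := (h 0).mul h1 hs
    rw [Fin.prod_univ_succ, ← (Fin.consEquiv fun _ => ℤ).hasSum_iff]
    refine h2.congr_fun fun p => ?_
    simp [Fin.prod_univ_succ]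

/-- Row i depends on l i alone, so each Leibniz term is a product of functions of separate
variables. The transpose makes the product run over rows. -/
theorem hasSum_det {n : ℕ} {w : Fin n → ℤ → Fin n → ℝ} {R : Fin n → Fin n → ℝ}
    (h : ∀ i j, HasSum (fun l => w i l j) (R i j)) :
    HasSum (fun l : Fin n → ℤ => (Matrix.of fun i j => w i (l i) j).det) (Matrix.of R).det := by
  simp only [← Matrix.det_transpose (Matrix.of _), Matrix.det_apply, Matrix.transpose_apply,
    Matrix.of_apply]
  exact hasSum_sum fun σ _ => (hasSum_pi_prod fun i => h i (σ i)).const_smul _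

/-- The tail sums of `g`. -/
noncomputable def tail (g : ℤ → ℝ) (m : ℤ) : ℝ := ∑' n, (Set.Ici m).indicator g n

theorem hasSum_tail {g : ℤ → ℝ} (hg : Summable g) (m : ℤ) :
    HasSum ((Set.Ici m).indicator g) (tail g m) := (hg.indicator _).hasSum

theorem tail_succ {g : ℤ → ℝ} (hg : Summable g) (m : ℤ) : tail g (m + 1) = -g m + tail g m := by
  have h := (hasSum_tail hg m).sub (hasSum_ite_eq m (g m))
  rw [neg_add_eq_sub]
  refine HasSum.unique (hasSum_tail hg (m + 1)) (h.congr_fun fun n => ?_)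
  rcases lt_trichotomy n m with h | h | h
  · simp [Set.indicator, h.ne, not_le.2 h, not_le.2 (show n < m + 1 by omega)]
  · subst h
    simp [Set.indicator]
  · simp [Set.indicator, h.ne', h.le, show m + 1 ≤ n by omega]

/-- Tails started from the shifted entries of `μ`, followed by the whole sum. -/
noncomputable def lowerTail {N : ℕ} (g : ℤ → ℝ) (S : ℝ) (μ : Fin N → ℤ) (i : Fin (N + 1)) (j : ℤ) :
    ℝ :=
  Fin.snoc (α := fun _ => ℝ) (fun k : Fin N => tail g (μ k - (k : ℕ) + j)) S i

/-- Tails started from the shifted entries of `μ`, preceded by zero. -/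
noncomputable def upperTail {N : ℕ} (g : ℤ → ℝ) (μ : Fin N → ℤ) (i : Fin (N + 1)) (j : ℤ) : ℝ :=
  Fin.cons (α := fun _ => ℝ) 0 (fun k : Fin N => tail g (μ k - (k : ℕ) + j)) i

/-- The upper tail of row i+1 is the lower tail of row i, so the differences are row operations and
only the lower tails matter. Their consecutive columns differ by -g, except in the constant last
row, which becomes (S, 0, …, 0). Expanding along it gives S (-1)^N det(-g), and the signs cancel. -/
theorem det_lowerTail_sub_upperTail {N : ℕ} {g : ℤ → ℝ} (hg : Summable g) (S : ℝ)
    (μ : Fin N → ℤ) :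
    (Matrix.of fun i j : Fin (N + 1) =>
      lowerTail g S μ i (j : ℕ) - upperTail g μ i (j : ℕ)).det =
      S * (Matrix.of fun i j : Fin N => g (μ i + (j : ℕ) - (i : ℕ))).det := by
  have h1 : (Matrix.of fun i j : Fin (N + 1) => lowerTail g S μ i (j : ℕ)).det =
      (Matrix.of fun i j : Fin (N + 1) =>
        lowerTail g S μ i (j : ℕ) - upperTail g μ i (j : ℕ)).det := by
    refine Matrix.det_eq_of_forall_row_eq_smul_add_pred (fun _ => 1) (fun j => ?_) fun i j => ?_
    · simp [upperTail]
    · simp [upperTail, lowerTail, Fin.snoc_castSucc]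
  have h2 : (Matrix.of fun i j : Fin (N + 1) => lowerTail g S μ i (j : ℕ)).det =
      (Matrix.of fun i j : Fin (N + 1) => Fin.snoc (α := fun _ => ℝ)
        (fun k : Fin N => Fin.cons (α := fun _ => ℝ) (tail g (μ k - (k : ℕ)))
          (fun j' : Fin N => -g (μ k + (j' : ℕ) - (k : ℕ))) j)
        (Fin.cons (α := fun _ => ℝ) S (fun _ => 0) j) i).det := by
    refine Matrix.det_eq_of_forall_col_eq_smul_add_pred (fun _ => 1) (fun i => ?_) fun i j => ?_
    · refine Fin.lastCases ?_ (fun k => ?_) i <;> simp [lowerTail]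
    · refine Fin.lastCases ?_ (fun k => ?_) i
      · simp [lowerTail]
      · simp only [Matrix.of_apply, lowerTail, Fin.snoc_castSucc, Fin.cons_succ, one_mul,
          Fin.val_succ, Fin.val_castSucc]
        push_cast
        rw [← add_assoc, tail_succ hg]
        congr 3
        ring
  rw [← h1, h2, Matrix.det_succ_row _ (Fin.last N), Fin.sum_univ_succ]
  have h3 : ((Matrix.of fun i j : Fin (N + 1) => Fin.snoc (α := fun _ => ℝ)
        (fun k : Fin N => Fin.cons (α := fun _ => ℝ) (tail g (μ k - (k : ℕ)))
          (fun j' : Fin N => -g (μ k + (j' : ℕ) - (k : ℕ))) j)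
        (Fin.cons (α := fun _ => ℝ) S (fun _ => 0) j) i).submatrix (Fin.last N).succAbove
          (Fin.succAbove 0)) =
      -(Matrix.of fun i j : Fin N => g (μ i + (j : ℕ) - (i : ℕ))) := by
    ext i j
    simp [Fin.succAbove_last, -Fin.snoc_apply_zero]
  rw [h3, Matrix.det_neg]
  simp only [Matrix.of_apply, Fin.snoc_last, Fin.cons_zero, Fin.cons_succ, mul_zero, zero_mul,
    Finset.sum_const_zero, add_zero, Fin.val_last, Fin.val_zero, Fintype.card_fin]
  have : ((-1 : ℝ) ^ N) * (-1) ^ N = 1 := by rw [← mul_pow]; simp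
  linear_combination
    (S * (Matrix.of fun i j : Fin N => g (μ i + (j : ℕ) - (i : ℕ))).det) * this

/-- The condition imposed on the entry `i` of a row by its interlacing with the row `μ` above. -/
def EntryInterlace {N : ℕ} (μ : Fin N → ℤ) (i : Fin (N + 1)) (l : ℤ) : Prop :=
  (∀ k : Fin N, k.castSucc = i → μ k ≤ l) ∧ ∀ k : Fin N, k.succ = i → l ≤ μ k

theorem interlace_iff {N : ℕ} {μ : Fin N → ℤ} {l : Fin (N + 1) → ℤ} :
    Interlace μ l ↔ ∀ i, EntryInterlace μ i (l i) := by
  constructor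
  · rintro h i
    exact ⟨fun k hk => hk ▸ (h k).2, fun k hk => hk ▸ (h k).1⟩
  · exact fun h k => ⟨(h k.succ).2 k rfl, (h k.castSucc).1 k rfl⟩

-- In the variable n = l + j - i the conditions μ_i ≤ l ≤ μ_{i-1} read μ_i - i + j ≤ n < μ_{i-1} -
-- (i-1) + j, so the sum is a difference of two tails of the same form. A missing bound gives S or
-- 0.
open Classical in
theorem hasSum_entry {N : ℕ} {a : ℤ → ℝ} {x S : ℝ} (hx : 0 < x)
    (hS : HasSum (fun n => a n * x ^ n) S) {μ : Fin N → ℤ} (hμ : Antitone μ) (i : Fin (N + 1))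
    (j : ℤ) :
    HasSum (fun l : ℤ => (if EntryInterlace μ i l then x ^ l else 0) * a (l + j - (i : ℕ)))
      (x ^ ((i : ℕ) : ℤ) * (x ^ (-j) * (lowerTail (fun n => a n * x ^ n) S μ i j -
        upperTail (fun n => a n * x ^ n) μ i j))) := by
  set g : ℤ → ℝ := fun n => a n * x ^ n with hg
  have hlow : HasSum (fun n => if ∀ k : Fin N, k.castSucc = i → μ k - (k : ℕ) + j ≤ n then g n
      else 0) (lowerTail g S μ i j) := by
    refine Fin.lastCases ?_ (fun k => ?_) i
    · rw [lowerTail, Fin.snoc_last]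
      refine hS.congr_fun fun n => ?_
      rw [if_pos]
      exact fun k hk => absurd hk (Fin.castSucc_lt_last k).ne
    · rw [lowerTail, Fin.snoc_castSucc]
      refine (hasSum_tail hS.summable _).congr_fun fun n => ?_
      simp [Set.indicator, Fin.castSucc_inj]
  have hup : HasSum (fun n => if ∃ k : Fin N, k.succ = i ∧ μ k - (k : ℕ) + j ≤ n then g n
      else 0) (upperTail g μ i j) := by
    refine Fin.cases ?_ (fun k => ?_) i
    · rw [upperTail, Fin.cons_zero]
      refine hasSum_zero.congr_fun fun n => ?_
      simp [Fin.succ_ne_zero]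
    · rw [upperTail, Fin.cons_succ]
      refine (hasSum_tail hS.summable _).congr_fun fun n => ?_
      simp [Set.indicator]
  have h := (((hlow.sub hup).mul_left (x ^ (-j))).mul_left (x ^ ((i : ℕ) : ℤ)))
  rw [← (Equiv.addRight (j - ((i : ℕ) : ℤ))).hasSum_iff] at h
  refine h.congr_fun fun l => ?_
  have e1 : (∀ k : Fin N, k.castSucc = i → μ k - (k : ℕ) + j ≤ l + (j - ((i : ℕ) : ℤ))) ↔
      ∀ k : Fin N, k.castSucc = i → μ k ≤ l := by
    refine forall_congr' fun k => forall_congr' fun hk => ?_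
    have : (i : ℕ) = k := by rw [← hk]; rfl
    rw [this]
    omega
  have e2 : (∃ k : Fin N, k.succ = i ∧ μ k - (k : ℕ) + j ≤ l + (j - ((i : ℕ) : ℤ))) ↔
      ¬ ∀ k : Fin N, k.succ = i → l ≤ μ k := by
    push Not
    refine exists_congr fun k => and_congr_right fun hk => ?_
    have : (i : ℕ) = k + 1 := by rw [← hk]; rfl
    rw [this]
    push_cast
    omega
  -- The subtracted tail must be contained in the other one; this is where μ has to be
  -- nonincreasing.
  have e3 : (¬ ∀ k : Fin N, k.succ = i → l ≤ μ k) → ∀ k : Fin N, k.castSucc = i → μ k ≤ l := by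
    push Not
    rintro ⟨k, hk, hl⟩ k' hk'
    refine (hμ ?_).trans hl.le
    rw [← Fin.val_fin_le]
    have h1 : (i : ℕ) = k + 1 := by rw [← hk]; rfl
    have h2 : (i : ℕ) = k' := by rw [← hk']; rfl
    omega
  have e4 : x ^ ((i : ℕ) : ℤ) * (x ^ (-j) * g (l + (j - ((i : ℕ) : ℤ)))) =
      x ^ l * a (l + j - (i : ℕ)) := by
    simp only [hg]
    rw [← add_sub_assoc, mul_left_comm (x ^ (-j)), mul_left_comm, ← zpow_add₀ hx.ne',
      ← zpow_add₀ hx.ne', mul_comm]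
    congr 2
    ring
  simp only [Function.comp_apply, Equiv.coe_addRight, e1, e2]
  by_cases h1 : ∀ k : Fin N, k.succ = i → l ≤ μ k
  · by_cases h2 : ∀ k : Fin N, k.castSucc = i → μ k ≤ l
    · rw [if_pos (show EntryInterlace μ i l from ⟨h2, h1⟩), if_pos h2, if_neg (not_not.2 h1), sub_zero, e4]
    · rw [if_neg fun h : EntryInterlace μ i l => h2 h.1, if_neg h2, if_neg (not_not.2 h1)]
      simp
  · rw [if_neg fun h : EntryInterlace μ i l => h1 h.2, if_pos (e3 h1), if_pos h1]
    simp

/-- Interlacing with μ is one condition per entry of l, so the summation is carried out row by row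
inside the determinant. The powers of x left by the index shifts cancel between rows and columns. -/
theorem hasSum_skewSchur_mul_det {N : ℕ} {a : ℤ → ℝ} {x S : ℝ} (hx : 0 < x)
    (hS : HasSum (fun n => a n * x ^ n) S) {μ : Fin N → ℤ} (hμ : Antitone μ) :
    HasSum (fun l : Fin (N + 1) → ℤ => skewSchur x l μ *
        (Matrix.of fun i j : Fin (N + 1) => a (l i + (j : ℕ) - (i : ℕ))).det)
      (S * (Matrix.of fun i j : Fin N => a (μ i + (j : ℕ) - (i : ℕ))).det) := by
  classical
  have h := (hasSum_det fun i j : Fin (N + 1) =>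
    hasSum_entry hx hS hμ i ((j : ℕ) : ℤ)).mul_left (x ^ (-∑ k, μ k))
  have hcancel : ∀ n : ℕ, (∏ i : Fin n, x ^ (((i : ℕ) : ℤ))) * ∏ i : Fin n, x ^ (-((i : ℕ) : ℤ)) =
      1 := fun n => by
    rw [← Finset.prod_mul_distrib]
    refine Finset.prod_eq_one fun i _ => ?_
    rw [← zpow_add₀ hx.ne', add_neg_cancel, zpow_zero]
  have hR : x ^ (-∑ k, μ k) * (Matrix.of fun i j : Fin (N + 1) => (x ^ ((i : ℕ) : ℤ) *
      (x ^ (-((j : ℕ) : ℤ)) * (lowerTail (fun n => a n * x ^ n) S μ i (j : ℕ) -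
        upperTail (fun n => a n * x ^ n) μ i (j : ℕ))))).det =
      S * (Matrix.of fun i j : Fin N => a (μ i + (j : ℕ) - (i : ℕ))).det := by
    have h1 := Matrix.det_mul_column (fun i : Fin (N + 1) => x ^ ((i : ℕ) : ℤ))
      (Matrix.of fun i j : Fin (N + 1) =>
        (x ^ (-((j : ℕ) : ℤ)) * (lowerTail (fun n => a n * x ^ n) S μ i (j : ℕ) -
          upperTail (fun n => a n * x ^ n) μ i (j : ℕ))))
    have h2 := Matrix.det_mul_row (fun j : Fin (N + 1) => x ^ (-((j : ℕ) : ℤ)))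
      (Matrix.of fun i j : Fin (N + 1) =>
        (lowerTail (fun n => a n * x ^ n) S μ i (j : ℕ) -
          upperTail (fun n => a n * x ^ n) μ i (j : ℕ)))
    simp only [Matrix.of_apply] at h1 h2
    rw [h1, h2, ← mul_assoc (∏ _, _), hcancel, one_mul, det_lowerTail_sub_upperTail hS.summable]
    have e : (Matrix.of fun i j : Fin N =>
        a (μ i + (j : ℕ) - (i : ℕ)) * x ^ (μ i + (j : ℕ) - (i : ℕ))) =
        Matrix.of fun i j : Fin N => x ^ (μ i) * (x ^ (-((i : ℕ) : ℤ)) *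
          (x ^ ((j : ℕ) : ℤ) * a (μ i + (j : ℕ) - (i : ℕ)))) := by
      ext i j
      simp only [Matrix.of_apply]
      rw [← mul_assoc (x ^ (-((i : ℕ) : ℤ))), ← zpow_add₀ hx.ne', ← mul_assoc,
        ← zpow_add₀ hx.ne', mul_comm]
      congr 2
      ring
    have h3 := Matrix.det_mul_column (fun i : Fin N => x ^ (μ i))
      (Matrix.of fun i j : Fin N => x ^ (-((i : ℕ) : ℤ)) *
          (x ^ ((j : ℕ) : ℤ) * a (μ i + (j : ℕ) - (i : ℕ))))
    have h4 := Matrix.det_mul_column (fun i : Fin N => x ^ (-((i : ℕ) : ℤ)))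
      (Matrix.of fun i j : Fin N => (x ^ ((j : ℕ) : ℤ) * a (μ i + (j : ℕ) - (i : ℕ))))
    have h5 := Matrix.det_mul_row (fun j : Fin N => x ^ ((j : ℕ) : ℤ))
      (Matrix.of fun i j : Fin N => a (μ i + (j : ℕ) - (i : ℕ)))
    simp only [Matrix.of_apply] at h3 h4 h5
    rw [e, h3, h4, h5, ← mul_assoc (∏ i : Fin N, x ^ (-((i : ℕ) : ℤ))),
      mul_comm (∏ i : Fin N, x ^ (-((i : ℕ) : ℤ))), hcancel, one_mul,
      prod_zpow_eq_zpow_sum _ hx.ne', mul_left_comm S, ← mul_assoc, ← zpow_add₀ hx.ne',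
      neg_add_cancel, zpow_zero, one_mul]
  rw [hR] at h
  refine h.congr_fun fun l => ?_
  have h1 := Matrix.det_mul_column
    (fun i : Fin (N + 1) => if EntryInterlace μ i (l i) then x ^ l i else 0)
    (Matrix.of fun i j : Fin (N + 1) => a (l i + (j : ℕ) - (i : ℕ)))
  simp only [Matrix.of_apply] at h1
  rw [h1, ← mul_assoc]
  congr 1
  rw [skewSchur]
  split_ifs with hI
  · rw [interlace_iff] at hI
    simp only [hI, if_true]
    rw [prod_zpow_eq_zpow_sum _ hx.ne', ← zpow_add₀ hx.ne', neg_add_eq_sub]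
  · rw [interlace_iff, not_forall] at hI
    obtain ⟨i, hi⟩ := hI
    rw [Finset.prod_eq_zero (Finset.mem_univ i) (if_neg hi), mul_zero]

/-! ### Weights of arrays -/

theorem Interlace.antitone {n : ℕ} {μ : Fin n → ℤ} {l : Fin (n + 1) → ℤ} (h : Interlace μ l) :
    Antitone l :=
  Fin.antitone_iff_succ_le.2 fun k => (h k).1.trans (h k).2

theorem skewSchur_nonneg {n : ℕ} {x : ℝ} (hx : 0 < x) (l : Fin (n + 1) → ℤ) (μ : Fin n → ℤ) :
    0 ≤ skewSchur x l μ := by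
  unfold skewSchur
  split_ifs
  · exact (zpow_pos hx _).le
  · exact le_rfl

theorem interlace_of_skewSchur_ne_zero {n : ℕ} {x : ℝ} {l : Fin (n + 1) → ℤ} {μ : Fin n → ℤ}
    (h : skewSchur x l μ ≠ 0) : Interlace μ l := by
  by_contra hI
  exact h (if_neg hI)

theorem arrayWeight_succ (c : ℕ → ℝ) (N : ℕ) (a : Arr) :
    arrayWeight c (N + 1) a = arrayWeight c N a * skewSchur (c N) (a (N + 1)) (a N) :=
  Finset.prod_range_succ _ _

theorem arrayWeight_congr {c c' : ℕ → ℝ} {N : ℕ} {a b : Arr} (hc : ∀ n < N, c n = c' n)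
    (h : ∀ n ≤ N, a n = b n) : arrayWeight c N a = arrayWeight c' N b := by
  refine Finset.prod_congr rfl fun n hn => ?_
  rw [Finset.mem_range] at hn
  rw [hc n hn, h n hn.le, h (n + 1) hn]

theorem interlace_of_arrayWeight_ne_zero {c : ℕ → ℝ} {N : ℕ} {a : Arr}
    (h : arrayWeight c N a ≠ 0) {n : ℕ} (hn : n < N) : Interlace (a n) (a (n + 1)) :=
  interlace_of_skewSchur_ne_zero (Finset.prod_ne_zero_iff.1 h n (Finset.mem_range.2 hn))

theorem antitone_of_arrayWeight_ne_zero {c : ℕ → ℝ} {N : ℕ} {a : Arr}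
    (h : arrayWeight c N a ≠ 0) : Antitone (a N) := by
  rcases N with _ | N
  · exact fun i => i.elim0
  · exact (interlace_of_arrayWeight_ne_zero h N.lt_succ_self).antitone

/-- The value of the generating function at a positive real point, as a sum. -/
noncomputable def genSum (ρ : Specialization) (x : ℝ) : ℝ := ∑' n : ℤ, psi ρ n * x ^ n

theorem hasSum_skewSchur_mul_schurSpec {ρ : Specialization} (hρ : ∀ i, ρ.αm i = 0) {x : ℝ}
    (hx : 0 < x) (hx1 : x ≤ 1) {N : ℕ} {μ : Fin N → ℤ} (hμ : Antitone μ) :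
    HasSum (fun l : Fin (N + 1) → ℤ => skewSchur x l μ * schurSpec ρ l)
      (genSum ρ x * schurSpec ρ μ) :=
  hasSum_skewSchur_mul_det hx (Specialization.summable_psi_mul_zpow hρ hx hx1).hasSum hμ

theorem skewSchur_mul_schurSpec_nonneg {ρ : Specialization} (hρ : ∀ i, ρ.αm i = 0) {x : ℝ}
    (hx : 0 < x) {N : ℕ} (μ : Fin N → ℤ) (l : Fin (N + 1) → ℤ) :
    0 ≤ skewSchur x l μ * schurSpec ρ l := by
  by_cases h : skewSchur x l μ = 0
  · rw [h, zero_mul]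
  · exact mul_nonneg (skewSchur_nonneg hx l μ)
      (Specialization.schurSpec_nonneg hρ (interlace_of_skewSchur_ne_zero h).antitone)

/-! ### Cylinders -/

theorem measurable_row (n : ℕ) : Measurable fun A : Arr => A n := measurable_pi_apply n

theorem preimage_frestrictLe_singleton (N : ℕ) (a : Arr) :
    Preorder.frestrictLe (π := fun n => Fin n → ℤ) N ⁻¹' {Preorder.frestrictLe N a} =
      cylinder N a := by
  ext A
  simp only [Set.mem_preimage, Set.mem_singleton_iff, cylinder, Set.mem_ofPred_eq]
  constructor
  · intro h n hn
    exact congrFun h ⟨n, Finset.mem_Iic.2 hn⟩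
  · intro h
    funext n
    exact h n (Finset.mem_Iic.1 n.2)

theorem measurable_frestrictLe (N : ℕ) :
    Measurable (Preorder.frestrictLe (π := fun n => Fin n → ℤ) N) :=
  Preorder.measurable_frestrictLe N

theorem measurableSet_cylinder (N : ℕ) (a : Arr) : MeasurableSet (cylinder N a) := by
  rw [← preimage_frestrictLe_singleton]
  exact measurable_frestrictLe N (measurableSet_singleton _)

theorem measurableSet_row_eq (n : ℕ) (l : Fin n → ℤ) : MeasurableSet {A : Arr | A n = l} :=
  measurable_row n (measurableSet_singleton l)

theorem hasSum_measureReal_inter_fiber {Ω ι : Type*} [MeasurableSpace Ω] [MeasurableSpace ι]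
    [MeasurableSingletonClass ι] [Countable ι] (M : Measure Ω) [IsFiniteMeasure M] {f : Ω → ι}
    (hf : Measurable f) {s : Set Ω} (hs : MeasurableSet s) :
    HasSum (fun i => M.real (s ∩ {x | f x = i})) (M.real s) := by
  have hm : ∀ i, MeasurableSet (s ∩ {x | f x = i}) := fun i =>
    hs.inter (hf (measurableSet_singleton i))
  have h : M s = ∑' i, M (s ∩ {x | f x = i}) := by
    rw [← measure_iUnion (fun i j hij => Set.disjoint_left.2 fun x hx hy =>
      hij (hx.2.symm.trans hy.2)) hm]
    congr 1
    ext x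
    simp
  have h2 : ∑' i, M (s ∩ {x | f x = i}) ≠ ⊤ := h ▸ measure_ne_top M s
  have := ENNReal.hasSum_toReal h2
  rwa [← ENNReal.tsum_toReal_eq (ENNReal.ne_top_of_tsum_ne_top h2), ← h] at this

theorem cylinder_inter_row (N : ℕ) (a : Arr) (l : Fin (N + 1) → ℤ) :
    cylinder N a ∩ {A | A (N + 1) = l} = cylinder (N + 1) (Function.update a (N + 1) l) := by
  ext A
  simp only [cylinder, Set.mem_inter_iff, Set.mem_ofPred_eq]
  constructor
  · rintro ⟨h1, h2⟩ n hn
    rcases hn.eq_or_lt with rfl | h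
    · rw [Function.update_self, h2]
    · rw [Function.update_of_ne h.ne, h1 n (Nat.lt_succ_iff.1 h)]
  · intro h
    refine ⟨fun n hn => ?_, ?_⟩
    · rw [h n (hn.trans N.le_succ), Function.update_of_ne (Nat.lt_succ_of_le hn).ne]
    · rw [h _ le_rfl, Function.update_self]

theorem arrayWeight_update_succ (c : ℕ → ℝ) (N : ℕ) (a : Arr) (l : Fin (N + 1) → ℤ) :
    arrayWeight c (N + 1) (Function.update a (N + 1) l) =
      arrayWeight c N a * skewSchur (c N) l (a N) := by
  rw [arrayWeight_succ, Function.update_self, Function.update_of_ne N.lt_succ_self.ne,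
    arrayWeight_congr (b := a) (fun _ _ => rfl)
      fun n hn => Function.update_of_ne (Nat.lt_succ_of_le hn).ne _ _]

/-- The joint weights of the first `N` rows follow from those of the first `N + 1` rows. -/
theorem cylinder_weight_of_succ {ρ : Specialization} (hρ : ∀ i, ρ.αm i = 0) {c : ℕ → ℝ} {N : ℕ}
    (hc : 0 < c N) (hc1 : c N ≤ 1) {M : Measure Arr} [IsFiniteMeasure M] {C : ℝ}
    (h : ∀ a, M.real (cylinder (N + 1) a) =
      C * (arrayWeight c (N + 1) a * schurSpec ρ (a (N + 1)))) (a : Arr) :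
    M.real (cylinder N a) = C * genSum ρ (c N) * (arrayWeight c N a * schurSpec ρ (a N)) := by
  have h1 := hasSum_measureReal_inter_fiber M (measurable_row (N + 1)) (measurableSet_cylinder N a)
  simp only [cylinder_inter_row, h, arrayWeight_update_succ, Function.update_self] at h1
  refine h1.unique ?_
  by_cases hw : arrayWeight c N a = 0
  · simp [hw, hasSum_zero]
  · have h2 := (hasSum_skewSchur_mul_schurSpec hρ hc hc1
      (antitone_of_arrayWeight_ne_zero hw)).mul_left (C * arrayWeight c N a)
    rw [show C * genSum ρ (c N) * (arrayWeight c N a * schurSpec ρ (a N)) =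
      C * arrayWeight c N a * (genSum ρ (c N) * schurSpec ρ (a N)) by ring]
    refine h2.congr_fun fun l => ?_
    ring

/-! ### Measures determined by their cylinders. -/

/-- The cylinders over the countably many possible initial rows partition the space, so C ∑ w = 1 =
C' ∑ w and the constants agree. -/
theorem measure_cylinder_eq_of_proportional {M M' : Measure Arr} [IsProbabilityMeasure M]
    [IsProbabilityMeasure M'] {N : ℕ} {w : Arr → ℝ} {C C' : ℝ}
    (h : ∀ a, M.real (cylinder N a) = C * w a) (h' : ∀ a, M'.real (cylinder N a) = C' * w a)
    (a : Arr) : M (cylinder N a) = M' (cylinder N a) := by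
  have hsurj : Function.Surjective (Preorder.frestrictLe (π := fun n => Fin n → ℤ) N) := by
    intro y
    refine ⟨fun n => if hn : n ∈ Finset.Iic N then y ⟨n, hn⟩ else 0, ?_⟩
    funext n
    exact dif_pos n.2
  have key : ∀ (P : Measure Arr) [IsProbabilityMeasure P] (D : ℝ),
      (∀ a, P.real (cylinder N a) = D * w a) → D * ∑' y, w (Function.surjInv hsurj y) = 1 := by
    intro P _ D hD
    have h1 := hasSum_measureReal_inter_fiber P (measurable_frestrictLe N) MeasurableSet.univ
    rw [probReal_univ] at h1
    rw [← tsum_mul_left, ← h1.tsum_eq]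
    refine tsum_congr fun y => ?_
    rw [← hD, Set.univ_inter, ← preimage_frestrictLe_singleton, Function.surjInv_eq hsurj]
    rfl
  have e := key M C h
  have e' := key M' C' h'
  have hC : C = C' := by
    have h0 : ∑' y, w (Function.surjInv hsurj y) ≠ 0 := right_ne_zero_of_mul (e ▸ one_ne_zero)
    exact mul_right_cancel₀ h0 (e.trans e'.symm)
  have := (h a).trans (hC ▸ (h' a).symm)
  exact (measureReal_eq_measureReal_iff).1 this

/-- The first N rows take countably many values, so cylinder masses determine their joint law for
every N, and projective limits are unique. -/
theorem measure_ext_of_cylinder {M M' : Measure Arr} [IsProbabilityMeasure M]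
    [IsProbabilityMeasure M'] (h : ∀ N a, M (cylinder N a) = M' (cylinder N a)) : M = M' := by
  have hmap : ∀ N, M.map (Preorder.frestrictLe (π := fun n => Fin n → ℤ) N) =
      M'.map (Preorder.frestrictLe N) := by
    intro N
    refine Measure.ext_of_singleton fun y => ?_
    rw [Measure.map_apply (measurable_frestrictLe N) (measurableSet_singleton _),
      Measure.map_apply (measurable_frestrictLe N) (measurableSet_singleton _)]
    by_cases hy : ∃ a, Preorder.frestrictLe (π := fun n => Fin n → ℤ) N a = y
    · obtain ⟨a, rfl⟩ := hy
      rw [preimage_frestrictLe_singleton, h]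
    · have : Preorder.frestrictLe (π := fun n => Fin n → ℤ) N ⁻¹' {y} = ∅ :=
        Set.eq_empty_iff_forall_notMem.2 fun a ha => hy ⟨a, ha⟩
      rw [this, measure_empty, measure_empty]
  let Q : (I : Finset ℕ) → Measure ((j : I) → Fin (j : ℕ) → ℤ) := fun I =>
    M.map (I.restrict (π := fun n => Fin n → ℤ))
  have hproj : IsProjectiveMeasureFamily (α := fun n : ℕ => Fin n → ℤ) Q := by
    intro I J hJI
    simp only [Q]
    rw [Measure.map_map (by fun_prop) (by fun_prop)]
    rfl
  refine IsProjectiveLimit.unique (α := fun n : ℕ => Fin n → ℤ) (P := Q) (fun I => rfl) ?_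
  rw [isProjectiveLimit_nat_iff hproj]
  exact fun N => (hmap N).symm

/-- Countably many null cylinders have null union. Since nonzero weights force interlacing, this
yields almost sure interlacing. -/
theorem ae_measure_cylinder_ne_zero (M : Measure Arr) (N : ℕ) :
    ∀ᵐ A ∂M, M (cylinder N A) ≠ 0 := by
  have h1 : ∀ᵐ y ∂(M.map (Preorder.frestrictLe (π := fun n => Fin n → ℤ) N)),
      M.map (Preorder.frestrictLe (π := fun n => Fin n → ℤ) N) {y} ≠ 0 :=
    (ae_iff_of_countable).2 fun _ h => h
  filter_upwards [ae_of_ae_map (measurable_frestrictLe N).aemeasurable h1] with A hA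
  rwa [Measure.map_apply (measurable_frestrictLe N) (measurableSet_singleton _),
    preimage_frestrictLe_singleton] at hA

/-! ### Existence and uniqueness of the Schur process -/

theorem genSum_pos {ρ : Specialization} (hρ : ∀ i, ρ.αm i = 0) {x : ℝ} (hx : 0 < x)
    (hx1 : x ≤ 1) : 0 < genSum ρ x := Specialization.tsum_psi_mul_zpow_pos hρ hx hx1

/-- The conditional law of a row given the previous one. -/
theorem exists_rowLaw {ρ : Specialization} (hρ : ∀ i, ρ.αm i = 0) {x : ℝ} (hx : 0 < x)
    (hx1 : x ≤ 1) {N : ℕ} (μ : Fin N → ℤ) :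
    ∃ p : PMF (Fin (N + 1) → ℤ), Antitone μ → 0 < schurSpec ρ μ → ∀ l,
      p l = ENNReal.ofReal (skewSchur x l μ * schurSpec ρ l / (genSum ρ x * schurSpec ρ μ)) := by
  by_cases h : Antitone μ ∧ 0 < schurSpec ρ μ
  · have hG := mul_pos (genSum_pos hρ hx hx1) h.2
    have hs := (hasSum_skewSchur_mul_schurSpec hρ hx hx1 h.1).div_const
      (genSum ρ x * schurSpec ρ μ)
    rw [div_self hG.ne'] at hs
    refine ⟨⟨fun l => ENNReal.ofReal (skewSchur x l μ * schurSpec ρ l /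
      (genSum ρ x * schurSpec ρ μ)), ?_⟩, fun _ _ _ => rfl⟩
    refine ENNReal.summable.hasSum_iff.2 ?_
    rw [← ENNReal.ofReal_tsum_of_nonneg (fun l =>
      div_nonneg (skewSchur_mul_schurSpec_nonneg hρ hx μ l) hG.le) hs.summable, hs.tsum_eq,
      ENNReal.ofReal_one]
  -- An arbitrary law: such rows carry no mass.
  · exact ⟨PMF.pure 0, fun h1 h2 => absurd ⟨h1, h2⟩ h⟩

/-- A Markov chain of rows whose joint weights are given by products of skew Schur functions. -/
theorem exists_measure_cylinder_weight {ρ : Specialization} (hρ : ∀ i, ρ.αm i = 0) {c : ℕ → ℝ}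
    (hc : ∀ n, 0 < c n) (hc1 : ∀ n, c n ≤ 1) :
    ∃ M : Measure Arr, IsProbabilityMeasure M ∧ ∀ (N : ℕ) (a : Arr), M.real (cylinder N a) =
      (∏ n ∈ Finset.range N, genSum ρ (c n))⁻¹ * (arrayWeight c N a * schurSpec ρ (a N)) := by
  choose p hp using fun (N : ℕ) (μ : Fin N → ℤ) => exists_rowLaw hρ (hc N) (hc1 N) μ
  let κ : (N : ℕ) → Kernel ((i : Finset.Iic N) → Fin (i : ℕ) → ℤ) (Fin (N + 1) → ℤ) := fun N =>
    Kernel.ofFunOfCountable fun y => (p N (y ⟨N, Finset.mem_Iic.2 le_rfl⟩)).toMeasure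
  have hκ : ∀ N, IsMarkovKernel (κ N) := fun N =>
    ⟨fun y => PMF.toMeasure.isProbabilityMeasure (p N (y ⟨N, Finset.mem_Iic.2 le_rfl⟩))⟩
  -- Row 0 is empty, so the chain starts deterministically; the Ionescu-Tulcea construction does the
  -- rest.
  let M : Measure Arr := Kernel.trajMeasure (X := fun n => Fin n → ℤ) (Measure.dirac 0) κ
  have hM : IsProbabilityMeasure M := by
    simp only [M]
    infer_instance
  have hstep : ∀ (N : ℕ) (a : Arr), M (cylinder (N + 1) a) =
      p N (a N) (a (N + 1)) * M (cylinder N a) := by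
    intro N a
    have h := Kernel.map_frestrictLe_trajMeasure_compProd_eq_map_trajMeasure
      (X := fun n => Fin n → ℤ) (μ₀ := Measure.dirac 0) (κ := κ) (a := N)
    have h2 := congrArg (fun m => m ({Preorder.frestrictLe N a} ×ˢ {a (N + 1)})) h
    rw [Measure.compProd_apply_prod (measurableSet_singleton _) (measurableSet_singleton _),
      Measure.map_apply (by fun_prop)
        ((measurableSet_singleton _).prod (measurableSet_singleton _)),
      Measure.restrict_singleton, lintegral_smul_measure, lintegral_dirac,
      Measure.map_apply (measurable_frestrictLe N) (measurableSet_singleton _),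
      preimage_frestrictLe_singleton] at h2
    have e : (fun x : Arr => (Preorder.frestrictLe (π := fun n => Fin n → ℤ) N x, x (N + 1))) ⁻¹'
        ({Preorder.frestrictLe N a} ×ˢ {a (N + 1)}) = cylinder (N + 1) a := by
      have h3 := cylinder_inter_row N a (a (N + 1))
      rw [Function.update_eq_self, ← preimage_frestrictLe_singleton] at h3
      rw [← h3]
      rfl
    rw [e] at h2
    rw [← h2, smul_eq_mul, mul_comm]
    congr 1
    exact (PMF.toMeasure_apply_singleton (p N (a N)) (a (N + 1)) (measurableSet_singleton _))
  refine ⟨M, hM, fun N => ?_⟩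
  induction N with
  | zero =>
    intro a
    have : cylinder 0 a = Set.univ := Set.eq_univ_of_forall fun A n hn => by
      obtain rfl := Nat.le_zero.1 hn
      exact Subsingleton.elim _ _
    simp [this, arrayWeight, schurSpec]
  | succ N ih =>
    intro a
    rw [Measure.real, hstep, ENNReal.toReal_mul, ← Measure.real, ih, arrayWeight_succ,
      Finset.prod_range_succ]
    by_cases hw : arrayWeight c N a = 0
    · simp [hw]
    have hanti := antitone_of_arrayWeight_ne_zero hw
    have hnn := skewSchur_mul_schurSpec_nonneg hρ (hc N) (a N)
    have hs := hasSum_skewSchur_mul_schurSpec hρ (hc N) (hc1 N) hanti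
    -- When s(ρ) vanishes on row N the transition law is arbitrary, but then the nonnegative terms
    -- of the branching sum add up to zero, so the weight of row N+1 vanishes as well.
    rcases (Specialization.schurSpec_nonneg hρ hanti).eq_or_lt with h0 | h0
    · rw [← h0, mul_zero] at hs
      have := congrFun ((hasSum_zero_iff_of_nonneg hnn).1 hs) (a (N + 1))
      simp only [Pi.zero_apply] at this
      rw [← h0, mul_assoc (arrayWeight c N a), this]
      simp
    · have hG := genSum_pos hρ (hc N) (hc1 N)
      rw [hp N (a N) hanti h0, ENNReal.toReal_ofReal (div_nonneg (hnn _) (mul_pos hG h0).le)]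
      field_simp

/-! ### The Gibbs property. -/

/-- The arrays which agree with `a` in the rows from `k` to `N`. -/
def window (k N : ℕ) (a : Arr) : Set Arr := {A | ∀ n, k ≤ n → n ≤ N → A n = a n}

theorem measurableSet_window (k N : ℕ) (a : Arr) : MeasurableSet (window k N a) := by
  simp only [window, Set.ofPred_forall]
  exact MeasurableSet.iInter fun n => MeasurableSet.iInter fun _ => MeasurableSet.iInter fun _ =>
    measurableSet_row_eq n (a n)

theorem window_succ_inter_row {k N : ℕ} (hk : k < N) (a : Arr) (l : Fin k → ℤ) :
    window (k + 1) N a ∩ {A | A k = l} = window k N (Function.update a k l) := by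
  ext A
  simp only [window, Set.mem_inter_iff, Set.mem_ofPred_eq]
  constructor
  · rintro ⟨h1, h2⟩ n hn hN
    rcases hn.eq_or_lt with rfl | h
    · rw [Function.update_self, h2]
    · rw [Function.update_of_ne h.ne', h1 n h hN]
  · intro h
    refine ⟨fun n hn hN => ?_, ?_⟩
    · rw [h n (by omega) hN, Function.update_of_ne (by omega)]
    · rw [h k le_rfl hk.le, Function.update_self]

/-- Summing out the rows below N one at a time builds the Schur function in c by the branching rule,
so row N has mass C s(c) s(ρ). The factor s(ρ) depends on row N only, hence plays no role in the
conditional law. -/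
theorem isGibbs_of_weight {ρ : Specialization} {c : ℕ → ℝ} {M : Measure Arr} [IsFiniteMeasure M]
    (h : ∀ N : ℕ, ∃ C : ℝ, ∀ a, M.real (cylinder N a) =
      C * (arrayWeight c N a * schurSpec ρ (a N))) : IsGibbs c M := by
  intro N a
  obtain ⟨C, hC⟩ := h N
  have key : ∀ k ≤ N, ∀ a, M.real (window k N a) = C * (schurFin c k (a k) *
      (∏ n ∈ Finset.Ico k N, skewSchur (c n) (a (n + 1)) (a n)) * schurSpec ρ (a N)) := by
    intro k
    induction k with
    | zero =>
      intro _ a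
      have : window 0 N a = cylinder N a := by
        ext A
        simp [window, cylinder]
      rw [this, hC, schurFin, one_mul, Nat.Ico_zero_eq_range, arrayWeight]
    | succ k ih =>
      intro hk a
      have h1 := hasSum_measureReal_inter_fiber M (measurable_row k)
        (measurableSet_window (k + 1) N a)
      rw [← h1.tsum_eq, schurFin, ← tsum_mul_right, ← tsum_mul_right, ← tsum_mul_left]
      refine tsum_congr fun μ => ?_
      rw [window_succ_inter_row hk, ih (Nat.le_of_succ_le hk),
        Finset.prod_eq_prod_Ico_succ_bot hk,
        Function.update_self, Function.update_of_ne k.succ_ne_self,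
        Function.update_of_ne (show N ≠ k by omega)]
      have e : ∏ n ∈ Finset.Ico (k + 1) N, skewSchur (c n) (Function.update a k μ (n + 1))
          (Function.update a k μ n) =
          ∏ n ∈ Finset.Ico (k + 1) N, skewSchur (c n) (a (n + 1)) (a n) := by
        refine Finset.prod_congr rfl fun n hn => ?_
        rw [Finset.mem_Ico] at hn
        rw [Function.update_of_ne (by omega), Function.update_of_ne (by omega)]
      rw [e]
      ring
  have h1 := key N le_rfl a
  have h2 : window N N a = {A | A N = a N} := by
    ext A
    simp only [window, Set.mem_ofPred_eq]
    exact ⟨fun h => h N le_rfl le_rfl, fun h n h1 h2 => by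
      obtain rfl := le_antisymm h1 h2
      exact h⟩
  rw [h2, Finset.Ico_self, Finset.prod_empty, mul_one] at h1
  rw [h1, hC]
  ring

theorem exists_isSchurProcess {ρ : Specialization} (hρ : ∀ i, ρ.αm i = 0) {q : ℝ} (hq : 0 < q)
    (hq1 : q < 1) : ∃ P : Measure Arr, IsSchurProcess q ρ P := by
  have hc : ∀ n : ℕ, 0 < q ^ n := pow_pos hq
  have hc1 : ∀ n : ℕ, q ^ n ≤ 1 := fun n => pow_le_one₀ hq.le hq1.le
  obtain ⟨M, hM, h⟩ := exists_measure_cylinder_weight hρ (c := fun n => q ^ n) hc hc1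
  refine ⟨M, hM, ?_, isGibbs_of_weight fun N => ⟨_, h N⟩, fun N =>
    ⟨∏ n ∈ Finset.range N, genSum ρ (q ^ n), Finset.prod_pos fun n _ =>
      genSum_pos hρ (hc n) (hc1 n), fun a => ?_⟩⟩
  · refine ae_all_iff.2 fun n => ?_
    filter_upwards [ae_measure_cylinder_ne_zero M (n + 1)] with A hA
    have h1 : M.real (cylinder (n + 1) A) ≠ 0 :=
      (ENNReal.toReal_pos hA (measure_ne_top _ _)).ne'
    rw [h] at h1
    exact interlace_of_arrayWeight_ne_zero
      (left_ne_zero_of_mul (right_ne_zero_of_mul h1)) n.lt_succ_self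
  · rw [h, one_div]

theorem IsSchurProcess.unique {q : ℝ} {ρ : Specialization} {P P' : Measure Arr}
    (h : IsSchurProcess q ρ P) (h' : IsSchurProcess q ρ P') : P = P' := by
  have := h.isProbabilityMeasure
  have := h'.isProbabilityMeasure
  refine measure_ext_of_cylinder fun N a => ?_
  obtain ⟨Z, -, hZ⟩ := h.weight N
  obtain ⟨Z', -, hZ'⟩ := h'.weight N
  exact measure_cylinder_eq_of_proportional hZ hZ' a

theorem existsUnique_isSchurProcess {ρ : Specialization} (hρ : ∀ i, ρ.αm i = 0) {q : ℝ}
    (hq : 0 < q) (hq1 : q < 1) : ∃! P : Measure Arr, IsSchurProcess q ρ P := by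
  obtain ⟨P, hP⟩ := exists_isSchurProcess hρ hq hq1
  exact ⟨P, hP, fun _ h => h.unique hP⟩

/-! ### The Markov maps exchange neighbouring parameters -/

theorem truncGeom_singleton (α : ℝ) (A k : ℕ) :
    truncGeom α A {k} = ENNReal.ofReal (if k < A then (1 - α) * α ^ k else
      if k = A then α ^ A else 0) := by
  simp only [truncGeom, Measure.add_apply, Measure.finsetSum_apply, Measure.smul_apply,
    smul_eq_mul, Measure.dirac_apply' _ (measurableSet_singleton k), Set.indicator_apply,
    Set.mem_singleton_iff, Pi.one_apply, mul_ite, mul_one, mul_zero, Finset.sum_ite_eq',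
    Finset.mem_range]
  split_ifs with h1 h2 h3 h3
  · omega
  · rw [add_zero]
  · rw [zero_add]
  · omega
  · omega
  · simp

/-- The probability that a truncated geometric jump started from the left end `m` of its segment
brings the coordinate `l` to `l'`. -/
noncomputable def jumpProb (α : ℝ) (m l l' : ℤ) : ℝ :=
  (truncGeom α (l - m).toNat).real {y : ℕ | m + (y : ℤ) = l'}

theorem jumpProb_of_lt (α : ℝ) {m l' : ℤ} (h : l' < m) (l : ℤ) : jumpProb α m l l' = 0 := by
  have : {y : ℕ | m + (y : ℤ) = l'} = ∅ := by
    ext y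
    simp only [Set.mem_ofPred_eq, Set.mem_empty_iff_false, iff_false]
    omega
  rw [jumpProb, this, measureReal_empty]

theorem jumpProb_add {α : ℝ} (h0 : 0 ≤ α) (h1 : α ≤ 1) (m : ℤ) (A k : ℕ) :
    jumpProb α m (m + A) (m + k) = if k < A then (1 - α) * α ^ k else
      if k = A then α ^ A else 0 := by
  have : {y : ℕ | m + (y : ℤ) = m + k} = {k} := by
    ext y
    simp
  rw [jumpProb, this, add_sub_cancel_left, Int.toNat_natCast, Measure.real, truncGeom_singleton,
    ENNReal.toReal_ofReal]
  split_ifs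
  · exact mul_nonneg (sub_nonneg.2 h1) (pow_nonneg h0 k)
  · exact pow_nonneg h0 A
  · exact le_rfl

/-- A truncated geometric jump reverses a geometric distribution on a segment. -/
theorem hasSum_jumpProb {α : ℝ} (h0 : 0 < α) (h1 : α ≤ 1) (m M l' : ℤ) :
    HasSum (fun l => if m ≤ l ∧ l ≤ M then α ^ (-l) * jumpProb α m l l' else 0)
      (if m ≤ l' ∧ l' ≤ M then α ^ (l' - m - M) else 0) := by
  rcases lt_or_ge l' m with hl | hl
  · simp [jumpProb_of_lt α hl, hl.not_ge, hasSum_zero]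
  rcases lt_or_ge M m with hM | hM
  · rw [if_neg (by omega)]
    refine hasSum_zero.congr_fun fun l => ?_
    rw [if_neg (by omega)]
  obtain ⟨k, rfl⟩ := Int.le.dest hl
  obtain ⟨n, rfl⟩ := Int.le.dest hM
  clear hl hM
  have hz : ∀ A : ℕ, α ^ (-(m + (A : ℤ))) = α ^ (-m) * (α ^ A)⁻¹ := fun A => by
    rw [neg_add, zpow_add₀ h0.ne', zpow_neg α (A : ℤ), zpow_natCast]
  have hz2 : ∀ k n : ℕ, α ^ (m + (k : ℤ) - m - (m + n)) = α ^ (-m) * α ^ k * (α ^ n)⁻¹ :=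
    fun k n => by
      rw [show m + (k : ℤ) - m - (m + n) = -m + k + -n by ring, zpow_add₀ h0.ne',
        zpow_add₀ h0.ne', zpow_neg α (n : ℤ), zpow_natCast, zpow_natCast]
  -- Induction on the length of the segment: the new starting point m + n + 1 contributes one term,
  -- and for targets below it the powers combine through α + (1 - α) = 1.
  induction n with
  | zero =>
    have h := hasSum_ite_eq m (α ^ (-m) * jumpProb α m m (m + k))
    have hj := jumpProb_add h0.le h1 m 0 k
    simp only [Nat.cast_zero, add_zero] at hj ⊢
    convert h using 1
    · funext l
      by_cases hl : l = m
      · simp [hl]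
      · rw [if_neg (by omega), if_neg hl]
    · rw [hj]
      by_cases hk : k = 0
      · simp [hk]
      · rw [if_neg (by omega), if_neg (by omega), if_neg hk, mul_zero]
  | succ n ih =>
    have h := ih.add (hasSum_ite_eq (m + (n + 1 : ℕ) : ℤ)
      (α ^ (-(m + (n + 1 : ℕ) : ℤ)) * jumpProb α m (m + (n + 1 : ℕ)) (m + k)))
    convert h using 1
    · funext l
      by_cases hl : l = m + (n + 1 : ℕ)
      · subst hl
        rw [if_pos (by omega), if_neg (by push_cast; omega), if_pos rfl, zero_add]
      · rw [if_neg hl, add_zero]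
        refine if_congr ?_ rfl rfl
        push_cast at hl ⊢
        omega
    · rw [jumpProb_add h0.le h1, hz, hz2, hz2]
      have hne : α ≠ 0 := h0.ne'
      rcases lt_trichotomy k (n + 1) with hk | hk | hk
      · rw [if_pos (by push_cast; omega), if_pos (by omega), if_pos hk, pow_succ]
        field_simp
        ring
      · subst hk
        rw [if_pos (by push_cast; omega), if_neg (by push_cast; omega), if_neg (lt_irrefl _),
          if_pos rfl, zero_add]
        field_simp
      · rw [if_neg (by push_cast; omega), if_neg (by omega), if_neg (by omega),
          if_neg (by omega)]
        simp

/-- The right end of the segment to which the entry `k` of the middle one of three consecutive rows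
is constrained by interlacing. -/
def upperEnd {m : ℕ} (μ : Fin m → ℤ) (ν : Fin (m + 2) → ℤ) (k : Fin (m + 1)) : ℤ :=
  Fin.cases (motive := fun _ => ℤ) (ν 0) (fun k' => min (μ k') (ν k'.succ.castSucc)) k

theorem lowerEnd_castSucc {m : ℕ} (μ : Fin m → ℤ) (ν : Fin (m + 2) → ℤ) (k : Fin m) :
    lowerEnd μ ν k.castSucc = max (μ k) (ν k.succ.castSucc) := by
  simp [lowerEnd]

theorem lowerEnd_last {m : ℕ} (μ : Fin m → ℤ) (ν : Fin (m + 2) → ℤ) :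
    lowerEnd μ ν (Fin.last m) = ν (Fin.last (m + 1)) := by
  simp [lowerEnd]

theorem interlace_and_interlace_iff {m : ℕ} (μ : Fin m → ℤ) (l : Fin (m + 1) → ℤ)
    (ν : Fin (m + 2) → ℤ) : Interlace μ l ∧ Interlace l ν ↔
      ∀ k, lowerEnd μ ν k ≤ l k ∧ l k ≤ upperEnd μ ν k := by
  constructor
  · rintro ⟨h1, h2⟩ k
    constructor
    · refine Fin.lastCases ?_ (fun k' => ?_) k
      · rw [lowerEnd_last]
        exact (h2 (Fin.last m)).1
      · rw [lowerEnd_castSucc]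
        exact max_le (h1 k').2 (h2 k'.castSucc).1
    · refine Fin.cases ?_ (fun k' => ?_) k
      · exact (h2 0).2
      · exact le_min (h1 k').1 (h2 k'.succ).2
  · intro h
    refine ⟨fun k => ⟨?_, ?_⟩, fun k => ⟨?_, ?_⟩⟩
    · exact (h k.succ).2.trans (min_le_left _ _)
    · have := (h k.castSucc).1
      rw [lowerEnd_castSucc] at this
      exact (le_max_left _ _).trans this
    · have := (h k).1
      revert this
      refine Fin.lastCases (fun this => ?_) (fun k' this => ?_) k
      · rwa [lowerEnd_last] at this
      · rw [lowerEnd_castSucc] at this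
        exact (le_max_right _ _).trans this
    · have := (h k).2
      revert this
      refine Fin.cases (fun this => ?_) (fun k' this => ?_) k
      · exact this
      · exact this.trans (min_le_right _ _)

/-- Each inner entry of ν is paired with an entry of μ, once through their maximum and once through
their minimum; the outer entries of ν are the two remaining ends. -/
theorem sum_lowerEnd_add_upperEnd {m : ℕ} (μ : Fin m → ℤ) (ν : Fin (m + 2) → ℤ) :
    ∑ k, (lowerEnd μ ν k + upperEnd μ ν k) = ∑ k, μ k + ∑ k, ν k := by
  rw [Finset.sum_add_distrib, Fin.sum_univ_castSucc (f := lowerEnd μ ν),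
    Fin.sum_univ_succ (f := upperEnd μ ν), Fin.sum_univ_castSucc (f := ν),
    Fin.sum_univ_succ (f := fun k : Fin (m + 1) => ν k.castSucc), lowerEnd_last]
  simp only [lowerEnd_castSucc, upperEnd, Fin.cases_zero, Fin.cases_succ, Fin.castSucc_zero]
  have : ∑ k, max (μ k) (ν k.succ.castSucc) + ∑ k, min (μ k) (ν k.succ.castSucc) =
      ∑ k, μ k + ∑ k : Fin m, ν k.succ.castSucc := by
    rw [← Finset.sum_add_distrib, ← Finset.sum_add_distrib]
    exact Finset.sum_congr rfl fun k _ => max_add_min _ _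
  linarith

-- Given μ and ν the entries of l decouple into geometric weights on segments.
open Classical in
theorem skewSchur_mul_skewSchur {m : ℕ} {α x : ℝ} (h0 : 0 < α) (hx : 0 < x) (μ : Fin m → ℤ)
    (l : Fin (m + 1) → ℤ) (ν : Fin (m + 2) → ℤ) :
    skewSchur x l μ * skewSchur (α * x) ν l =
      x ^ (∑ k, ν k - ∑ k, μ k) * α ^ (∑ k, ν k) *
        ∏ k, if lowerEnd μ ν k ≤ l k ∧ l k ≤ upperEnd μ ν k then α ^ (-l k) else 0 := by
  by_cases h : Interlace μ l ∧ Interlace l ν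
  · have h2 := (interlace_and_interlace_iff μ l ν).1 h
    simp only [h2, and_self, if_true]
    rw [skewSchur, if_pos h.1, skewSchur, if_pos h.2, prod_zpow_eq_zpow_sum _ h0.ne', mul_zpow,
      mul_assoc, ← zpow_add₀ h0.ne', mul_left_comm, ← zpow_add₀ hx.ne', mul_comm,
      Finset.sum_neg_distrib]
    congr 2
    ring
  · have h2 := h
    rw [interlace_and_interlace_iff, not_forall] at h2
    obtain ⟨k, hk⟩ := h2
    rw [Finset.prod_eq_zero (Finset.mem_univ k) (if_neg hk), mul_zero, skewSchur, skewSchur]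
    by_cases h3 : Interlace μ l
    · rw [if_neg fun h4 => h ⟨h3, h4⟩, mul_zero]
    · rw [if_neg h3, zero_mul]

-- The exponents are shifted by the segment ends so that the prefactor is the one of
-- `skewSchur_mul_skewSchur`; `sum_lowerEnd_add_upperEnd` accounts for the shift.
open Classical in
theorem skewSchur_mul_skewSchur_swap {m : ℕ} {α x : ℝ} (h0 : 0 < α) (hx : 0 < x) (μ : Fin m → ℤ)
    (l : Fin (m + 1) → ℤ) (ν : Fin (m + 2) → ℤ) :
    skewSchur (α * x) l μ * skewSchur x ν l =
      x ^ (∑ k, ν k - ∑ k, μ k) * α ^ (∑ k, ν k) *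
        ∏ k, if lowerEnd μ ν k ≤ l k ∧ l k ≤ upperEnd μ ν k then
          α ^ (l k - lowerEnd μ ν k - upperEnd μ ν k) else 0 := by
  by_cases h : Interlace μ l ∧ Interlace l ν
  · have h2 := (interlace_and_interlace_iff μ l ν).1 h
    have h3 := sum_lowerEnd_add_upperEnd μ ν
    rw [Finset.sum_add_distrib] at h3
    simp only [h2, and_self, if_true]
    rw [skewSchur, if_pos h.1, skewSchur, if_pos h.2, prod_zpow_eq_zpow_sum _ h0.ne', mul_zpow,
      mul_assoc, mul_assoc, ← zpow_add₀ h0.ne', ← zpow_add₀ hx.ne', mul_comm,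
      Finset.sum_sub_distrib, Finset.sum_sub_distrib]
    congr 2
    · ring
    · linarith
  · have h2 := h
    rw [interlace_and_interlace_iff, not_forall] at h2
    obtain ⟨k, hk⟩ := h2
    rw [Finset.prod_eq_zero (Finset.mem_univ k) (if_neg hk), mul_zero, skewSchur, skewSchur]
    by_cases h3 : Interlace μ l
    · rw [if_neg fun h4 => h ⟨h3, h4⟩, mul_zero]
    · rw [if_neg h3, zero_mul]

theorem hasSum_skewSchur_swap {m : ℕ} {α x : ℝ} (h0 : 0 < α) (h1 : α ≤ 1) (hx : 0 < x)
    (μ : Fin m → ℤ) (l' : Fin (m + 1) → ℤ) (ν : Fin (m + 2) → ℤ) :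
    HasSum (fun l : Fin (m + 1) → ℤ => skewSchur x l μ * skewSchur (α * x) ν l *
      ∏ k, jumpProb α (lowerEnd μ ν k) (l k) (l' k))
      (skewSchur (α * x) l' μ * skewSchur x ν l') := by
  classical
  have h := (hasSum_pi_prod fun k => hasSum_jumpProb h0 h1 (lowerEnd μ ν k) (upperEnd μ ν k)
    (l' k)).mul_left (x ^ (∑ k, ν k - ∑ k, μ k) * α ^ (∑ k, ν k))
  rw [skewSchur_mul_skewSchur_swap h0 hx]
  refine h.congr_fun fun l => ?_
  rw [skewSchur_mul_skewSchur h0 hx, mul_assoc, ← Finset.prod_mul_distrib]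
  congr 1
  refine Finset.prod_congr rfl fun k _ => ?_
  rw [ite_mul, zero_mul]

/-! ### The iterated Markov map -/

/-- The parameters obtained from `1, q, q², …` by moving `1` to the position `m`. -/
noncomputable def movedParam (q : ℝ) (m n : ℕ) : ℝ :=
  if n < m then q ^ (n + 1) else if n = m then 1 else q ^ n

theorem isProbabilityMeasure_lseq {q : ℝ} (hq : 0 < q) (hq1 : q < 1) {M : Measure Arr}
    [IsProbabilityMeasure M] (m : ℕ) : IsProbabilityMeasure (lseq q M m) := by
  induction m with
  | zero => assumption
  | succ m ih =>
    have := isMarkovKernel_lmap (pow_nonneg hq.le (m + 1)) (pow_le_one₀ hq.le hq1.le) m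
    change IsProbabilityMeasure ((lseq q M m).bind (lmap (q ^ (m + 1)) m))
    infer_instance

/-- The arrays which agree with `a` in all the rows up to `N` but the row `m`. -/
def puncturedCylinder (m N : ℕ) (a : Arr) : Set Arr := {A | ∀ n ≤ N, n ≠ m → A n = a n}

theorem measurableSet_puncturedCylinder (m N : ℕ) (a : Arr) :
    MeasurableSet (puncturedCylinder m N a) := by
  simp only [puncturedCylinder, Set.ofPred_forall]
  exact MeasurableSet.iInter fun n => MeasurableSet.iInter fun _ => MeasurableSet.iInter fun _ =>
    measurableSet_row_eq n (a n)

theorem puncturedCylinder_inter_row {m N : ℕ} (hm : m ≤ N) (a : Arr) (l : Fin m → ℤ) :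
    puncturedCylinder m N a ∩ {A | A m = l} = cylinder N (Function.update a m l) := by
  ext A
  simp only [puncturedCylinder, cylinder, Set.mem_inter_iff, Set.mem_ofPred_eq]
  constructor
  · rintro ⟨h1, h2⟩ n hn
    by_cases h : n = m
    · subst h
      rw [Function.update_self, h2]
    · rw [Function.update_of_ne h, h1 n hn h]
  · intro h
    refine ⟨fun n hn hnm => ?_, ?_⟩
    · rw [h n hn, Function.update_of_ne hnm]
    · rw [h m hm, Function.update_self]

/-- Only row m+1 moves, so the cylinder is reached only from arrays agreeing with a in its other
rows; independence of the jumps gives the product. -/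
theorem lmap_cylinder {α : ℝ} {m N : ℕ} (hN : m + 2 ≤ N) (a A : Arr) :
    lmap α m A (cylinder N a) = (puncturedCylinder (m + 1) N a).indicator (fun A =>
      ∏ k, truncGeom α (A (m + 1) k - lowerEnd (a m) (a (m + 2)) k).toNat
        {y : ℕ | lowerEnd (a m) (a (m + 2)) k + (y : ℤ) = a (m + 1) k}) A := by
  have hu : Measurable (updateRow m A) := (measurable_updateRow m).comp measurable_prodMk_left
  change (jumpLaw α (A m) (A (m + 1)) (A (m + 2))).map (updateRow m A) (cylinder N a) = _
  rw [Measure.map_apply hu (measurableSet_cylinder N a)]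
  by_cases hA : A ∈ puncturedCylinder (m + 1) N a
  · have e0 : A m = a m := hA m (by omega) (by omega)
    have e2 : A (m + 2) = a (m + 2) := hA (m + 2) hN (by omega)
    have : updateRow m A ⁻¹' cylinder N a = Set.univ.pi fun k =>
        {y : ℕ | lowerEnd (a m) (a (m + 2)) k + (y : ℤ) = a (m + 1) k} := by
      ext Y
      simp only [Set.mem_preimage, cylinder, Set.mem_ofPred_eq, Set.mem_pi, Set.mem_univ,
        true_imp_iff, updateRow]
      rw [e0, e2]
      constructor
      · intro h k
        have := h (m + 1) (by omega)
        rw [Function.update_self] at this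
        exact congrFun this k
      · intro h n hn
        by_cases hnm : n = m + 1
        · subst hnm
          rw [Function.update_self]
          exact funext h
        · rw [Function.update_of_ne hnm]
          exact hA n hn hnm
    have hfin := finite_truncGeom α
    rw [Set.indicator_of_mem hA, this, jumpLaw, Measure.pi_pi, e0, e2]
  · have : updateRow m A ⁻¹' cylinder N a = ∅ := by
      refine Set.eq_empty_iff_forall_notMem.2 fun Y hY => hA fun n hn hnm => ?_
      have := hY n hn
      rwa [updateRow, Function.update_of_ne hnm] at this
    rw [Set.indicator_of_notMem hA, this, measure_empty]

theorem bind_lmap_cylinder {α : ℝ} {m N : ℕ} (hN : m + 2 ≤ N) (M : Measure Arr) (a : Arr) :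
    M.bind (lmap α m) (cylinder N a) = ∑' l : Fin (m + 1) → ℤ,
      M (cylinder N (Function.update a (m + 1) l)) *
        ∏ k, truncGeom α (l k - lowerEnd (a m) (a (m + 2)) k).toNat
          {y : ℕ | lowerEnd (a m) (a (m + 2)) k + (y : ℤ) = a (m + 1) k} := by
  rw [Measure.bind_apply (measurableSet_cylinder N a) (lmap α m).aemeasurable]
  simp only [lmap_cylinder hN]
  rw [lintegral_indicator (measurableSet_puncturedCylinder _ _ _)]
  have h := lintegral_map (μ := M.restrict (puncturedCylinder (m + 1) N a))
    (f := fun l : Fin (m + 1) → ℤ =>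
      ∏ k, truncGeom α (l k - lowerEnd (a m) (a (m + 2)) k).toNat
        {y : ℕ | lowerEnd (a m) (a (m + 2)) k + (y : ℤ) = a (m + 1) k})
    (measurable_of_countable _) (measurable_row (m + 1))
  rw [← h, lintegral_countable']
  refine tsum_congr fun l => ?_
  rw [Measure.map_apply (measurable_row (m + 1)) (measurableSet_singleton l),
    Measure.restrict_apply (measurable_row (m + 1) (measurableSet_singleton l)), mul_comm,
    Set.inter_comm]
  congr 2
  exact puncturedCylinder_inter_row (by omega) a l

theorem arrayWeight_update {c : ℕ → ℝ} {m N : ℕ} (hN : m + 2 ≤ N) (a : Arr)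
    (l : Fin (m + 1) → ℤ) : arrayWeight c N (Function.update a (m + 1) l) =
      (∏ n ∈ (Finset.range N \ {m, m + 1}), skewSchur (c n) (a (n + 1)) (a n)) *
        (skewSchur (c m) l (a m) * skewSchur (c (m + 1)) (a (m + 2)) l) := by
  have hsub : ({m, m + 1} : Finset ℕ) ⊆ Finset.range N := by
    intro n hn
    simp only [Finset.mem_insert, Finset.mem_singleton] at hn
    rw [Finset.mem_range]
    omega
  rw [arrayWeight, ← Finset.prod_sdiff hsub, Finset.prod_pair (by omega), Function.update_self,
    Function.update_of_ne (show m ≠ m + 1 by omega),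
    Function.update_of_ne (show m + 1 + 1 ≠ m + 1 by omega)]
  congr 1
  refine Finset.prod_congr rfl fun n hn => ?_
  simp only [Finset.mem_sdiff, Finset.mem_insert, Finset.mem_singleton, not_or] at hn
  rw [Function.update_of_ne (by omega), Function.update_of_ne (by omega)]

/-- The map `L_α` at the row `m + 1` exchanges the parameters of the rows `m + 1` and `m + 2`. -/
theorem bind_lmap_weight {ρ : Specialization} {α : ℝ} (h0 : 0 < α) (h1 : α ≤ 1) {m N : ℕ}
    (hN : m + 2 ≤ N) {c c' : ℕ → ℝ} (hc : 0 < c m) (hα : c (m + 1) = α * c m)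
    (hcm : c' m = c (m + 1)) (hcm1 : c' (m + 1) = c m)
    (hcn : ∀ n, n ≠ m → n ≠ m + 1 → c' n = c n) {M : Measure Arr} [IsFiniteMeasure M] {C : ℝ}
    (h : ∀ a, M.real (cylinder N a) = C * (arrayWeight c N a * schurSpec ρ (a N))) (a : Arr) :
    (M.bind (lmap α m)).real (cylinder N a) =
      C * (arrayWeight c' N a * schurSpec ρ (a N)) := by
  have hfin := finite_truncGeom α
  have hs := (hasSum_skewSchur_swap h0 h1 hc (a m) (a (m + 1)) (a (m + 2))).mul_left
    (C * (∏ n ∈ (Finset.range N \ {m, m + 1}), skewSchur (c n) (a (n + 1)) (a n)) *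
      schurSpec ρ (a N))
  have hprod : ∏ n ∈ (Finset.range N \ {m, m + 1}), skewSchur (c' n) (a (n + 1)) (a n) =
      ∏ n ∈ (Finset.range N \ {m, m + 1}), skewSchur (c n) (a (n + 1)) (a n) := by
    refine Finset.prod_congr rfl fun n hn => ?_
    simp only [Finset.mem_sdiff, Finset.mem_insert, Finset.mem_singleton, not_or] at hn
    rw [hcn n hn.2.1 hn.2.2]
  have hw := arrayWeight_update (c := c') hN a (a (m + 1))
  rw [Function.update_eq_self, hprod, hcm, hcm1, hα] at hw
  rw [Measure.real, bind_lmap_cylinder hN, ENNReal.tsum_toReal_eq fun l =>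
    ENNReal.mul_ne_top (measure_ne_top _ _) (ENNReal.prod_ne_top fun k _ => measure_ne_top _ _),
    hw]
  rw [show ∀ P S T : ℝ, C * (P * S * T) = C * P * T * S from fun P S T => by ring, ← hs.tsum_eq]
  refine tsum_congr fun l => ?_
  have e := h (Function.update a (m + 1) l)
  -- Row N is not the updated one, so s(ρ) is a common factor of the sum.
  rw [arrayWeight_update hN, Function.update_of_ne (show N ≠ m + 1 by omega), hα] at e
  rw [ENNReal.toReal_mul, ENNReal.toReal_prod, ← Measure.real, e]
  change _ * ∏ k, jumpProb α (lowerEnd (a m) (a (m + 2)) k) (l k) (a (m + 1) k) = _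
  ring

/-- When the map with α = q^{m+1} acts, rows m+1 and m+2 carry 1 and q^{m+1}: their ratio is exactly
α. -/
theorem lseq_weight {ρ : Specialization} {q : ℝ} (hq : 0 < q) (hq1 : q < 1) {P : Measure Arr}
    [IsProbabilityMeasure P] {N : ℕ} {C : ℝ} (h : ∀ a, P.real (cylinder N a) =
      C * (arrayWeight (fun n => q ^ n) N a * schurSpec ρ (a N))) {m : ℕ} (hm : m + 1 ≤ N)
    (a : Arr) : (lseq q P m).real (cylinder N a) =
      C * (arrayWeight (movedParam q m) N a * schurSpec ρ (a N)) := by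
  induction m generalizing a with
  | zero =>
    rw [lseq, h, arrayWeight_congr (c' := movedParam q 0) (b := a) (fun n _ => ?_) fun _ _ => rfl]
    by_cases hn : n = 0 <;> simp [movedParam, hn]
  | succ m ih =>
    have := isProbabilityMeasure_lseq hq hq1 (M := P) m
    refine bind_lmap_weight (pow_pos hq (m + 1)) (pow_le_one₀ hq.le hq1.le) hm
      (c := movedParam q m) ?_ ?_ ?_ ?_ (fun n h1 h2 => ?_) (ih (by omega)) a
    · simp [movedParam]
    · simp [movedParam]
    · simp [movedParam]
    · simp [movedParam]
    · simp only [movedParam]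
      by_cases h3 : n < m
      · rw [if_pos h3, if_pos (by omega)]
      · rw [if_neg h3, if_neg h1, if_neg (by omega), if_neg h2]

theorem skewSchur_mul_param {n : ℕ} {q : ℝ} (hq : q ≠ 0) (x : ℝ) (l : Fin (n + 1) → ℤ)
    (μ : Fin n → ℤ) :
    q ^ (∑ k, μ k) * skewSchur (x * q) l μ = q ^ (∑ k, l k) * skewSchur x l μ := by
  unfold skewSchur
  split_ifs
  · rw [mul_zpow, mul_left_comm, ← zpow_add₀ hq, add_sub_cancel, mul_comm]
  · rw [mul_zero, mul_zero]

/-- Each skew factor gains q to the difference of consecutive row sums, and the exponents telescope.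
-/
theorem arrayWeight_mul_param {q : ℝ} (hq : q ≠ 0) (c : ℕ → ℝ) (N : ℕ) (a : Arr) :
    arrayWeight (fun n => c n * q) N a = q ^ (∑ k, a N k) * arrayWeight c N a := by
  induction N with
  | zero => simp [arrayWeight]
  | succ N ih =>
    rw [arrayWeight_succ, arrayWeight_succ, ih, mul_right_comm, skewSchur_mul_param hq]
    ring

theorem IsSchurProcess.isIteratedLImage {ρ : Specialization} (hρ : ∀ i, ρ.αm i = 0) {q : ℝ}
    (hq : 0 < q) (hq1 : q < 1) {P P' : Measure Arr} (hP : IsSchurProcess q ρ P)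
    (hP' : IsSchurProcess q (ρ.modify q hq hq1) P') : IsIteratedLImage q P P' := by
  intro N
  have := hP.isProbabilityMeasure
  have := hP'.isProbabilityMeasure
  have := isProbabilityMeasure_lseq hq hq1 (M := P) (N + 1)
  have hc : ∀ n, 0 < movedParam q (N + 1) n := fun n => by
    unfold movedParam
    split_ifs <;> positivity
  have hc1 : ∀ n, movedParam q (N + 1) n ≤ 1 := fun n => by
    unfold movedParam
    split_ifs
    · exact pow_le_one₀ hq.le hq1.le
    · exact le_rfl
    · exact pow_le_one₀ hq.le hq1.le
  obtain ⟨Z, -, hZ⟩ := hP.weight (N + 2)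
  obtain ⟨Z', -, hZ'⟩ := hP'.weight N
  obtain ⟨g, -, hg⟩ := Specialization.exists_schurSpec_modify hρ hq hq1 N
  -- The N+1 maps involve N+2 rows. The last two, with parameters 1 and q^{N+1}, are summed out
  -- afterwards, leaving q, …, q^N.
  have h1 := lseq_weight hq hq1 hZ (le_refl (N + 2))
  have h2 := cylinder_weight_of_succ hρ (hc (N + 1)) (hc1 (N + 1)) h1
  have h3 := cylinder_weight_of_succ hρ (hc N) (hc1 N) h2
  generalize 1 / Z * genSum ρ _ * genSum ρ _ = C at h3
  refine measure_cylinder_eq_of_proportional hZ' (C' := C * g) fun a => ?_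
  rw [h3, arrayWeight_congr (c' := fun n => q ^ n * q) (b := a)
    (fun n hn => by rw [movedParam, if_pos (by omega), pow_succ]) fun _ _ => rfl,
    arrayWeight_mul_param hq.ne', mul_right_comm (q ^ _), hg]
  ring

end TwoSidedSchur

theorem mainTheorem6 (q : ℝ) (hq : 0 < q) (hq1 : q < 1) (ρ : TwoSidedSchur.Specialization)
    (hρ : ∀ i, ρ.αm i = 0) :
    (∃! P : MeasureTheory.Measure TwoSidedSchur.Arr, TwoSidedSchur.IsSchurProcess q ρ P) ∧
    (∃! P' : MeasureTheory.Measure TwoSidedSchur.Arr,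
      TwoSidedSchur.IsSchurProcess q (ρ.modify q hq hq1) P') ∧
    ∀ P P' : MeasureTheory.Measure TwoSidedSchur.Arr,
      TwoSidedSchur.IsSchurProcess q ρ P →
      TwoSidedSchur.IsSchurProcess q (ρ.modify q hq hq1) P' →
      TwoSidedSchur.IsIteratedLImage q P P' :=
  ⟨TwoSidedSchur.existsUnique_isSchurProcess hρ hq hq1,
    TwoSidedSchur.existsUnique_isSchurProcess (fun _ => rfl) hq hq1,
    fun _ _ hP hP' => hP.isIteratedLImage hρ hq hq1 hP'⟩
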